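/- **Setting.** Let $X$ be a measurable space with measurable diagonal and $\lambda$ a $\sigma$-finite reference measure on $X$ (e.g. counting or Lebesgue measure). For $\theta\in\mathbb R$ let $\mu_\theta$ be a probability measure on $X$ with unnormalized density $g_\theta\ge 0$ with respect to $\lambda$ ($g_\theta\propto\mu_\theta$), and let $q(x'\mid x)$ be a jointly measurable proposal density with respect to $\lambda$. Put $$\alpha_\theta(x'\mid x)=\min\Bigl(1,\frac{g_\theta(x')}{g_\theta(x)}\frac{q(x\mid x')}{q(x'\mid x)}\Bigr),$$ with the convention that $\alpha_\theta(x'\mid x)=1$ if $g_\theta(x)q(x'\mid x)=0$. A *Metropolis–Hastings (MH) sampler* of $\mu_\theta$ with proposal $q$ and initial state $x_1$ is a Markov chain $Z^\theta_1,Z^\theta_2,\dots$ with $Z_1^\theta=x_1$ almost surely, in which, given $Z^\theta_t=x$, one draws independently $x'\sim q(\cdot\mid x)$ and $U\sim\mathrm{Unif}[0,1]$ and sets $Z^\theta_{t+1}=x'$ if $U\le\alpha_\theta(x'\mid x)$ and $Z^\theta_{t+1}=x$ otherwise. **Algorithm** ($T$-sample differentiable MH, $T\ge1$, at the parameter value $\theta$).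 Inputs: $g$, a function $f:X\to\mathbb R$, $q$, a start state $x_1$ and a Markov kernel $q_{xy}(\cdot,\cdot\mid x,y)$ on $X\times X$. Start with $\partial S=0$, $y_1=x_1$, $w_1=0$. For $i=1,\dots,T-1$: 1. Draw $(x',y')\sim q_{xy}(\cdot,\cdot\mid x_i,y_i)$ and, independently, $U\sim\mathrm{Unif}[0,1]$. Set $x_{i+1}=x'$ if $U\le\alpha_\theta(x'\mid x_i)$ and $x_{i+1}=x_i$ otherwise; set $y_{i+1}=y'$ if $U\le\alpha_\theta(y'\mid y_i)$ and $y_{i+1}=y_i$ otherwise. 2. If $U\le\alpha_\theta(x'\mid x_i)$, set $w=\alpha_\theta(x'\mid x_i)^{-1}\max\bigl(0,-\tfrac{\partial}{\partial\theta}\alpha_\theta(x'\mid x_i)\bigr)$; otherwise set $w=(1-\alpha_\theta(x'\mid x_i))^{-1}\max\bigl(0,\tfrac{\partial}{\partial\theta}\alpha_\theta(x'\mid x_i)\bigr)$. 3. If $y_{i+1}=x_{i+1}$, reset $w_i=0$. Set $w_{i+1}=w+w_i$. Draw an independent $\varpi\sim\mathrm{Unif}[0,1]$. If $\varpi\, w_{i+1}<w$,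 replace $y_{i+1}$ by $x_i$ if $U\le\alpha_\theta(x'\mid x_i)$, and by $x'$ otherwise. 4. Add $w_{i+1}\bigl(f(y_{i+1})-f(x_{i+1})\bigr)$ to $\partial S$. The output is $\partial S/T$. **Theorem.** Suppose that for all $x,y$, if $(x',y')\sim q_{xy}(\cdot,\cdot\mid x,y)$ then $x'\sim q(\cdot\mid x)$ and $y'\sim q(\cdot\mid y)$, and furthermore that if $x=y$ then $x'=y'$ almost surely. Let $f$ be bounded and measurable, let $x_1\in X$ and $T\ge1$, and for each $\eta\in\mathbb R$ let $Z^\eta$ be an MH sampler of $\mu_\eta$ with proposal $q$ and initial state $x_1$. Let $\theta\in\mathbb R$ and assume that the acceptance probability is regular at $\theta$ in the following sense. For $1\le t<T$ let $\nu_t$ be the joint law of $Z^\theta_t$ and a candidate $x'\sim q(\cdot\mid Z^\theta_t)$. Then, for each such $t$, $\eta\mapsto\alpha_\eta(x'\mid x)$ is differentiable at $\theta$ for $\nu_t$-almost every $(x,x')$; and there is a function $K$ on $X\times X$, integrable with respect to each $\nu_t$, such that for each such $t$ and all $\eta$ close enough to $\theta$, $|\alpha_\eta(x'\mid x)-\alpha_\theta(x'\mid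 x)|\le K(x,x')\,|\eta-\theta|$ for $\nu_t$-almost every $(x,x')$. Then the output of the algorithm is an integrable random variable, the function $\eta\mapsto\mathbb E\bigl[\frac1T\sum_{t=1}^T f(Z_t^\eta)\bigr]$ is differentiable at $\theta$, and the output is an unbiased estimator of its derivative: $$\mathbb E\Bigl[\frac{\partial S}{T}\Bigr]=\frac{\partial}{\partial\theta}\,\mathbb E\Bigl[\frac1T\sum_{t=1}^T f(Z_t^\theta)\Bigr].$$ -/

import Mathlib

open MeasureTheory ProbabilityTheory Filter Topology
open scoped NNReal ENNReal unitInterval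

noncomputable section

namespace DiffMH

variable {X : Type*} [MeasurableSpace X]

/-- The proposal distribution `q(· ∣ x)`, as a kernel, when `q x x'` is its density `q(x' ∣ x)` with
respect to the reference measure `lam`. -/
def proposalKernel (lam : Measure X) [SigmaFinite lam] (q : X → X → ℝ≥0) : Kernel X X :=
  Kernel.withDensity (Kernel.const X lam) (fun x x' => (q x x' : ℝ≥0∞))

open Classical in
/-- The acceptance probability
`α(x' ∣ x) = min (1, (g(x') / g(x)) * (q(x ∣ x') / q(x' ∣ x)))`
with the usual convention that it is `1` where the denominator `g(x) q(x' ∣ x)` vanishes. -/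
def acceptProb (g : X → ℝ≥0) (q : X → X → ℝ≥0) (x x' : X) : ℝ :=
  if g x * q x x' = 0 then 1
  else min 1 (((g x' : ℝ) / (g x : ℝ)) * ((q x' x : ℝ) / (q x x' : ℝ)))

open Classical in
/-- The accept/reject step at state `x` with candidate `x'` and uniform number `u`. -/
def acceptReject (a : X → X → ℝ) (x x' : X) (u : I) : X :=
  if (u : ℝ) ≤ a x x' then x' else x

/-- One Metropolis-Hastings transition: draw `x' ∼ q(· ∣ x)` and, independently, `u ∼ Unif[0,1]`,
then accept or reject. -/
def mhKernel (lam : Measure X) [SigmaFinite lam] (g : X → ℝ≥0) (q : X → X → ℝ≥0) : Kernel X X :=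
  (Kernel.id ×ₖ (proposalKernel lam q ×ₖ Kernel.const X (volume : Measure I))).map
    (fun p : X × X × I => acceptReject (acceptProb g q) p.1 p.2.1 p.2.2)

/-- `Z 1, Z 2, …` is a Metropolis-Hastings sampler started at `x₁`: given `Z 1, …, Z t`, the next
state has law `mhKernel lam g q (Z t)`. (`Z 0` plays no role.) -/
structure IsMHSampler {Ω : Type*} [MeasurableSpace Ω] (lam : Measure X) [SigmaFinite lam]
    (g : X → ℝ≥0) (q : X → X → ℝ≥0) (x₁ : X) (P : Measure Ω) (Z : ℕ → Ω → X) : Prop where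
  measurable : ∀ t, 1 ≤ t → Measurable (Z t)
  init : ∀ᵐ ω ∂P, Z 1 ω = x₁
  step : ∀ (t : ℕ) (ht : 1 ≤ t),
    P.map (fun ω => ((fun i : Finset.Icc 1 t => Z i ω), Z (t + 1) ω)) =
      (P.map (fun ω => (fun i : Finset.Icc 1 t => Z i ω))) ⊗ₘ
        (mhKernel lam g q).comap
          (fun h : Finset.Icc 1 t → X => h ⟨t, Finset.mem_Icc.2 ⟨ht, le_rfl⟩⟩)
          (measurable_pi_apply _)

/-- `qxy` is a proposal coupling of `q`: its marginals at `(x, y)` are `q(· ∣ x)` and `q(· ∣ y)`, and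
it proposes the same candidate for both chains when they are in the same state. -/
structure IsProposalCoupling (lam : Measure X) [SigmaFinite lam] (q : X → X → ℝ≥0)
    (qxy : Kernel (X × X) (X × X)) : Prop where
  fst_eq : ∀ x y, (qxy (x, y)).map Prod.fst = proposalKernel lam q x
  snd_eq : ∀ x y, (qxy (x, y)).map Prod.snd = proposalKernel lam q y
  diag : ∀ x, ∀ᵐ p ∂(qxy (x, x)), p.1 = p.2

/-- The variables `(x, y, w, ∂S)` of the differentiable Metropolis-Hastings algorithm: primal state,
alternative state, weight of the alternative, running derivative estimate. -/
abbrev DState (X : Type*) : Type _ := X × X × ℝ × ℝ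

/-- The random numbers `((x', y'), U, ϖ)` drawn in one iteration. -/
abbrev DNoise (X : Type*) : Type _ := (X × X) × I × I

open Classical in
/-- The weight of a flip of the accept/reject decision of the primal chain; `a` is the acceptance
probability and `da` its derivative in the parameter. -/
def flipWeight (a da : X → X → ℝ) (x x' : X) (u : I) : ℝ :=
  if (u : ℝ) ≤ a x x' then (a x x')⁻¹ * max 0 (-(da x x'))
  else (1 - a x x')⁻¹ * max 0 (da x x')

open Classical in
/-- One iteration of the loop of the differentiable Metropolis-Hastings algorithm. -/
def dmhStep (a da : X → X → ℝ) (f : X → ℝ) : DState X → DNoise X → DState X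
  | (x, y, w, S), ((x', y'), u, v) =>
    -- MH step for primal and alternative, with the same uniform number `u`
    let xNew : X := acceptReject a x x' u
    let yProp : X := acceptReject a y y' u
    -- stochastic derivative weight of the new alternative
    let wFlip : ℝ := flipWeight a da x x' u
    -- drop the current alternative if it has recoupled
    let wOld : ℝ := if yProp = xNew then 0 else w
    let wNew : ℝ := wFlip + wOld
    -- prune: choose between the current alternative and the new one
    let yFlip : X := if (u : ℝ) ≤ a x x' then x else x'
    let yNew : X := if (v : ℝ) * wNew < wFlip then yFlip else yProp
    (xNew, yNew, wNew, S + wNew * (f yNew - f xNew))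

/-- The conditional law of the random numbers of one iteration given the current variables:
`(x', y') ∼ qxy(·, · ∣ x, y)` and `U, ϖ ∼ Unif[0,1]`, all drawn independently. -/
def noiseKernel (qxy : Kernel (X × X) (X × X)) : Kernel (DState X) (DNoise X) :=
  (qxy.comap (fun s : DState X => (s.1, s.2.1))
      (measurable_fst.prodMk (measurable_fst.comp measurable_snd))) ×ₖ
    Kernel.const (DState X) ((volume : Measure I).prod (volume : Measure I))

/-- The law of the variables of the algorithm after `n` iterations of the loop. -/
def dmhLaw (a da : X → X → ℝ) (f : X → ℝ) (qxy : Kernel (X × X) (X × X)) (x₁ : X) :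
    ℕ → Measure (DState X)
  | 0 => Measure.dirac (x₁, x₁, 0, 0)
  | n + 1 => ((dmhLaw a da f qxy x₁ n) ⊗ₘ noiseKernel qxy).map (fun p => dmhStep a da f p.1 p.2)

/-- The law of the output `∂S / T` of the `T`-sample differentiable Metropolis-Hastings algorithm,
which runs `T - 1` iterations, at the parameter value `θ`. -/
def dmhOutputLaw (g : ℝ → X → ℝ≥0) (q : X → X → ℝ≥0) (f : X → ℝ)
    (qxy : Kernel (X × X) (X × X)) (x₁ : X) (T : ℕ) (θ : ℝ) : Measure ℝ :=
  (dmhLaw (acceptProb (g θ) q)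
      (fun x x' => deriv (fun η : ℝ => acceptProb (g η) q x x') θ) f qxy x₁ (T - 1)).map
    (fun s => s.2.2.2 / (T : ℝ))

end DiffMH

end

/-! Write P_η for the transition operator `acceptOp` at the parameter η, π_t for the law of the
θ-chain after t transitions, and D for the θ-derivative of the acceptance probability. Both sides of
the claim are reduced to the same double sum.

Analytic side: the expectation of f after m transitions is P_η^m f evaluated at the start state.
Differentiating one factor at a time gives the sum over i < m of the integrals of D(x,x')(h(x') -
h(x)), with h = P_θ^(m-1-i) f, against the joint law of state and candidate at time i
(`IsRegularChain.hasDerivAt_integral_iterate`).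

Algorithmic side: follow the functional A_n(h) = E[w (h(y) - h(x))] for all bounded h at once.
Primal and alternative each move by P_θ marginally, whatever the coupling; pruning and recoupling do
not change the mean; a flip of the current decision contributes exactly the D-term. Hence A_{n+1}(h)
= A_n(P_θ h) + D-term (`alternativeIntegral_nextLaw`). Unrolling yields the sum above, and the
running estimate accumulates A_n(f) (`IsRegularChain.isLoopLaw_dmhLaw`).

The delicate point is that regularity holds only along the θ-chain, so P_η^m f tends to P_θ^m f
merely in L¹(π_t), and candidates that are never accepted are invisible to π_{t+1}. Where the
acceptance probability is 0 it is minimal in the parameter, so D vanishes there and such candidates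
do not matter; `tendsto_integral_mul_abs_of_weight` turns this into convergence. This fact and its
counterpart at acceptance probability 1 also make the divisions in the flip weight harmless. -/

namespace DiffMH

/-! ### Bounded integrands, weighted L¹ convergence, uniform thresholds -/

section Generic

variable {α : Type*} [MeasurableSpace α]

theorem integrable_of_abs_le {μ : Measure α} [IsFiniteMeasure μ] {F : α → ℝ} {C : ℝ}
    (hm : Measurable F) (hb : ∀ x, |F x| ≤ C) : Integrable F μ :=
  Integrable.of_bound hm.aestronglyMeasurable C (ae_of_all _ hb)

/-- The expression is the convex combination of A and B with weights c and 1 - c. This is why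
transitions preserve sup bounds. -/
theorem abs_add_mul_sub_le {c A B C : ℝ} (h0 : 0 ≤ c) (h1 : c ≤ 1) (hA : |A| ≤ C)
    (hB : |B| ≤ C) : |B + c * (A - B)| ≤ C := by
  rw [abs_le] at *
  constructor <;> nlinarith

/-- If `φ i` is uniformly bounded and tends to zero in `L¹(w μ)`, then it tends to zero in
`L¹(|k| μ)` for every integrable `k` that vanishes where `w` does. -/
theorem tendsto_integral_mul_abs_of_weight {ι : Type*} {l : Filter ι} {μ : Measure α}
    [IsFiniteMeasure μ] {φ : ι → α → ℝ} {w k : α → ℝ} {C : ℝ}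
    (hφ : ∀ i, Measurable (φ i)) (hφ0 : ∀ i x, 0 ≤ φ i x) (hφC : ∀ i x, φ i x ≤ C)
    (hw : Measurable w) (hw0 : ∀ x, 0 ≤ w x) (hw1 : ∀ x, w x ≤ 1)
    (hk : Integrable k μ) (hkw : ∀ᵐ x ∂μ, w x = 0 → k x = 0)
    (hlim : Tendsto (fun i => ∫ x, φ i x * w x ∂μ) l (𝓝 0)) :
    Tendsto (fun i => ∫ x, φ i x * |k x| ∂μ) l (𝓝 0) := by
  have hint : ∀ M : ℕ, Integrable (fun x => max (|k x| - M * w x) 0) μ := fun M =>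
    (hk.abs.sub ((integrable_of_abs_le hw (C := 1) fun x => by
      rw [abs_of_nonneg (hw0 x)]; exact hw1 x).const_mul _)).pos_part
  -- The part of |k| exceeding M w vanishes as M grows: pointwise it is eventually 0 where w > 0,
  -- and k = 0 where w = 0. Below the excess, M w controls |k|.
  have hM : Tendsto (fun M : ℕ => ∫ x, max (|k x| - M * w x) 0 ∂μ) atTop (𝓝 0) := by
    have := tendsto_integral_filter_of_dominated_convergence (l := atTop) (μ := μ)
      (F := fun (M : ℕ) x => max (|k x| - M * w x) 0) (f := fun _ => (0 : ℝ)) (fun x => |k x|)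
      (Eventually.of_forall fun M => (hint M).aestronglyMeasurable)
      (Eventually.of_forall fun M => ae_of_all _ fun x => by
        have : 0 ≤ (M : ℝ) * w x := mul_nonneg M.cast_nonneg (hw0 x)
        rw [Real.norm_eq_abs, abs_of_nonneg (le_max_right _ _)]
        exact max_le (by linarith) (abs_nonneg _)) hk.abs
      (by
        filter_upwards [hkw] with x hx
        rcases (hw0 x).eq_or_lt with h | h
        · simp [hx h.symm, ← h]
        · refine tendsto_const_nhds.congr' ?_
          have ht : Tendsto (fun M : ℕ => (M : ℝ) * w x) atTop atTop :=
            tendsto_natCast_atTop_atTop.atTop_mul_const h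
          filter_upwards [ht.eventually_ge_atTop |k x|] with M hM
          rw [max_eq_right (by linarith)])
    simpa using this
  rw [Metric.tendsto_nhds]
  intro ε hε
  have hC : Tendsto (fun M : ℕ => C * ∫ x, max (|k x| - M * w x) 0 ∂μ) atTop (𝓝 0) := by
    simpa using hM.const_mul C
  -- M is fixed first, uniformly in i, using only φ ≤ C; then i is taken far enough for the M w
  -- part.
  obtain ⟨M, hMε⟩ := (hC.eventually_lt_const (half_pos hε)).exists
  have hl : Tendsto (fun i => M * ∫ x, φ i x * w x ∂μ) l (𝓝 0) := by
    simpa using hlim.const_mul (M : ℝ)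
  filter_upwards [hl.eventually_lt_const (half_pos hε)] with i hi
  have hφb : ∀ x, ‖φ i x‖ ≤ C := fun x => by
    rw [Real.norm_eq_abs, abs_of_nonneg (hφ0 i x)]; exact hφC i x
  have i1 : Integrable (fun x => φ i x * |k x|) μ :=
    hk.abs.bdd_mul (hφ i).aestronglyMeasurable (ae_of_all _ hφb)
  have i2 : Integrable (fun x => φ i x * w x) μ := by
    refine Integrable.bdd_mul (c := C) ?_ (hφ i).aestronglyMeasurable (ae_of_all _ hφb)
    exact integrable_of_abs_le hw (C := 1) fun x => by
      rw [abs_of_nonneg (hw0 x)]; exact hw1 x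
  have hle : ∫ x, φ i x * |k x| ∂μ ≤
      ∫ x, (M * (φ i x * w x) + C * max (|k x| - M * w x) 0) ∂μ := by
    refine integral_mono i1 ((i2.const_mul _).add ((hint M).const_mul _)) fun x => ?_
    have h1 := le_max_left (|k x| - M * w x) 0
    have h2 := le_max_right (|k x| - M * w x) 0
    have h3 := mul_le_mul_of_nonneg_left h1 (hφ0 i x)
    have h4 := mul_le_mul_of_nonneg_right (hφC i x) h2
    simp only
    linarith
  rw [integral_add (i2.const_mul _) ((hint M).const_mul _), integral_const_mul,
    integral_const_mul] at hle
  rw [Real.dist_eq, sub_zero, abs_of_nonneg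
    (integral_nonneg fun x => mul_nonneg (hφ0 i x) (abs_nonneg _))]
  linarith

theorem integral_ite_le_unitInterval {c : ℝ} (h0 : 0 ≤ c) (h1 : c ≤ 1) (A B : ℝ) :
    ∫ u : I, (if (u : ℝ) ≤ c then A else B) = B + c * (A - B) := by
  have hs : MeasurableSet {u : I | (u : ℝ) ≤ c} :=
    measurableSet_le measurable_subtype_coe measurable_const
  have hv : (volume : Measure I).real {u : I | (u : ℝ) ≤ c} = c := by
    have : {u : I | (u : ℝ) ≤ c} = Set.Iic (⟨c, h0, h1⟩ : I) := by
      ext u; simp [← Subtype.coe_le_coe]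
    rw [this, measureReal_def, unitInterval.volume_Iic, ENNReal.toReal_ofReal h0]
  have : (fun u : I => if (u : ℝ) ≤ c then A else B) =
      fun u => B + {u : I | (u : ℝ) ≤ c}.indicator (fun _ => A - B) u := by
    funext u
    by_cases h : (u : ℝ) ≤ c <;> simp [h]
  rw [this, integral_add (integrable_const _) ((integrable_const _).indicator hs),
    integral_indicator_const _ hs, hv]
  simp

theorem integral_ite_lt_unitInterval {c : ℝ} (h0 : 0 ≤ c) (h1 : c ≤ 1) (A B : ℝ) :
    ∫ u : I, (if (u : ℝ) < c then A else B) = B + c * (A - B) := by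
  have hs : MeasurableSet {u : I | (u : ℝ) < c} :=
    measurableSet_lt measurable_subtype_coe measurable_const
  have hv : (volume : Measure I).real {u : I | (u : ℝ) < c} = c := by
    have : {u : I | (u : ℝ) < c} = Set.Iio (⟨c, h0, h1⟩ : I) := by
      ext u; simp [← Subtype.coe_lt_coe]
    rw [this, measureReal_def, unitInterval.volume_Iio, ENNReal.toReal_ofReal h0]
  have : (fun u : I => if (u : ℝ) < c then A else B) =
      fun u => B + {u : I | (u : ℝ) < c}.indicator (fun _ => A - B) u := by
    funext u
    by_cases h : (u : ℝ) < c <;> simp [h]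
  rw [this, integral_add (integrable_const _) ((integrable_const _).indicator hs),
    integral_indicator_const _ hs, hv]
  simp

end Generic

/-! ### The transition operator on bounded functions -/

section Operator

variable {X : Type*} [MeasurableSpace X]

/-- The transition operator on functions of the chain with proposal kernel `κ` and acceptance
probability `a`. -/
noncomputable def acceptOp (κ : Kernel X X) (a : X → X → ℝ) (h : X → ℝ) (x : X) : ℝ :=
  ∫ x', (h x + a x x' * (h x' - h x)) ∂κ x

/-- Measurable functions with values in `[0, 1]`. -/
structure IsAcceptProb (a : X → X → ℝ) : Prop where
  measurable : Measurable fun p : X × X => a p.1 p.2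
  nonneg : ∀ x x', 0 ≤ a x x'
  le_one : ∀ x x', a x x' ≤ 1

variable {κ : Kernel X X} [IsMarkovKernel κ] {a : X → X → ℝ} {h : X → ℝ} {C : ℝ}

theorem IsAcceptProb.measurable_mix (ha : IsAcceptProb a) (hm : Measurable h) :
    Measurable fun p : X × X => h p.1 + a p.1 p.2 * (h p.2 - h p.1) := by
  have := ha.measurable
  fun_prop

theorem IsAcceptProb.abs_mix_le (ha : IsAcceptProb a) (hC : ∀ x, |h x| ≤ C) (x x' : X) :
    |h x + a x x' * (h x' - h x)| ≤ C :=
  abs_add_mul_sub_le (ha.nonneg x x') (ha.le_one x x') (hC x') (hC x)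

theorem measurable_acceptOp (ha : IsAcceptProb a) (hm : Measurable h) :
    Measurable (acceptOp κ a h) :=
  ((ha.measurable_mix hm).stronglyMeasurable.integral_kernel_prod_right'
    (κ := κ)).measurable

theorem abs_acceptOp_le (ha : IsAcceptProb a) (hC : ∀ x, |h x| ≤ C) (x : X) :
    |acceptOp κ a h x| ≤ C := by
  have := norm_integral_le_of_norm_le_const (μ := κ x)
    (f := fun x' => h x + a x x' * (h x' - h x)) (C := C)
    (ae_of_all _ fun x' => ha.abs_mix_le hC x x')
  simpa [acceptOp] using this

theorem measurable_iterate_acceptOp (ha : IsAcceptProb a) (hm : Measurable h) (m : ℕ) :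
    Measurable ((acceptOp κ a)^[m] h) := by
  induction m with
  | zero => exact hm
  | succ m ih => rw [Function.iterate_succ_apply']; exact measurable_acceptOp ha ih

theorem abs_iterate_acceptOp_le (ha : IsAcceptProb a) (hC : ∀ x, |h x| ≤ C) (m : ℕ) (x : X) :
    |(acceptOp κ a)^[m] h x| ≤ C := by
  induction m generalizing x with
  | zero => exact hC x
  | succ m ih => rw [Function.iterate_succ_apply']; exact abs_acceptOp_le ha ih x

theorem integral_acceptOp {π : Measure X} [IsFiniteMeasure π] (ha : IsAcceptProb a)
    (hm : Measurable h) (hC : ∀ x, |h x| ≤ C) :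
    ∫ x, acceptOp κ a h x ∂π = ∫ p, (h p.1 + a p.1 p.2 * (h p.2 - h p.1)) ∂(π ⊗ₘ κ) := by
  rw [Measure.integral_compProd (integrable_of_abs_le (ha.measurable_mix hm)
    fun p => ha.abs_mix_le hC p.1 p.2)]
  rfl

end Operator

end DiffMH

/-! ### Differentiating the iterated transition operator along the chain -/

namespace DiffMH

variable {X : Type*} [MeasurableSpace X]

/-- `π 0, …, π N` are the successive laws of the chain with proposal kernel `κ` and acceptance
probability `a θ`, and up to time `N` the acceptance probability has at `θ` the derivative `D` and
an integrable Lipschitz bound `K`. -/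
structure IsRegularChain (κ : Kernel X X) (a : ℝ → X → X → ℝ) (θ : ℝ) (π : ℕ → Measure X)
    (D K : X × X → ℝ) (N : ℕ) : Prop where
  isProbabilityMeasure : ∀ t, IsProbabilityMeasure (π t)
  isAcceptProb : ∀ η, IsAcceptProb (a η)
  integral_succ : ∀ t (h : X → ℝ) (C : ℝ), Measurable h → (∀ x, |h x| ≤ C) →
    ∫ x, h x ∂(π (t + 1)) = ∫ x, acceptOp κ (a θ) h x ∂(π t)
  measurable_deriv : Measurable D
  hasDerivAt : ∀ t < N, ∀ᵐ p ∂(π t ⊗ₘ κ), HasDerivAt (fun η => a η p.1 p.2) (D p) θ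
  integrable_bound : ∀ t < N, Integrable K (π t ⊗ₘ κ)
  lipschitz : ∀ t < N, ∀ᶠ η in 𝓝 θ, ∀ᵐ p ∂(π t ⊗ₘ κ),
    |a η p.1 p.2 - a θ p.1 p.2| ≤ K p * |η - θ|

/-- The derivative in the parameter of one transition from the law `π`, tested against `h`. -/
noncomputable def flipIntegral (κ : Kernel X X) (D : X × X → ℝ) (π : Measure X) (h : X → ℝ) : ℝ :=
  ∫ p, D p * (h p.2 - h p.1) ∂(π ⊗ₘ κ)

namespace IsRegularChain

variable {κ : Kernel X X} [IsMarkovKernel κ] {a : ℝ → X → X → ℝ} {θ : ℝ} {π : ℕ → Measure X}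
  {D K : X × X → ℝ} {N : ℕ} {h : X → ℝ} {C : ℝ}

omit [IsMarkovKernel κ] in
theorem abs_slope_le {t : ℕ} (R : IsRegularChain κ a θ π D K N) (ht : t < N) :
    ∀ᶠ η in 𝓝[≠] θ, ∀ᵐ p ∂(π t ⊗ₘ κ), |slope (fun η => a η p.1 p.2) θ η| ≤ K p := by
  filter_upwards [(R.lipschitz t ht).filter_mono nhdsWithin_le_nhds, self_mem_nhdsWithin]
    with η hη hne
  filter_upwards [hη] with p hp
  have : 0 < |η - θ| := abs_pos.2 (sub_ne_zero.2 hne)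
  rw [slope_def_field, abs_div, div_le_iff₀ this]
  exact hp

omit [IsMarkovKernel κ] in
theorem abs_deriv_le {t : ℕ} (R : IsRegularChain κ a θ π D K N) (ht : t < N) :
    ∀ᵐ p ∂(π t ⊗ₘ κ), |D p| ≤ K p := by
  -- The null set in the slope bound depends on η, so the limit is taken along a sequence, where
  -- countably many null sets can be merged.
  obtain ⟨u, hu⟩ := exists_seq_tendsto (𝓝[≠] θ)
  obtain ⟨n₀, hn₀⟩ := eventually_atTop.1 (hu.eventually (R.abs_slope_le ht))
  have : ∀ᵐ p ∂(π t ⊗ₘ κ), ∀ n, n₀ ≤ n → |slope (fun η => a η p.1 p.2) θ (u n)| ≤ K p := by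
    rw [ae_all_iff]
    intro n
    by_cases hn : n₀ ≤ n
    · filter_upwards [hn₀ n hn] with p hp _ using hp
    · exact ae_of_all _ fun p h => absurd h hn
  filter_upwards [this, R.hasDerivAt t ht] with p hp hd
  exact le_of_tendsto ((hasDerivAt_iff_tendsto_slope.1 hd).comp hu).abs
    (eventually_atTop.2 ⟨n₀, hp⟩)

omit [IsMarkovKernel κ] in
theorem integrable_deriv {t : ℕ} (R : IsRegularChain κ a θ π D K N) (ht : t < N) :
    Integrable D (π t ⊗ₘ κ) :=
  (R.integrable_bound t ht).mono' R.measurable_deriv.aestronglyMeasurable (R.abs_deriv_le ht)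

omit [IsMarkovKernel κ] in
-- A parameter value at which a nonnegative function is 0 is a minimum, so the derivative vanishes
-- by Fermat's rule.
theorem deriv_eq_zero_of_eq_zero {t : ℕ} (R : IsRegularChain κ a θ π D K N) (ht : t < N) :
    ∀ᵐ p ∂(π t ⊗ₘ κ), a θ p.1 p.2 = 0 → D p = 0 := by
  filter_upwards [R.hasDerivAt t ht] with p hd h0
  refine IsLocalMin.hasDerivAt_eq_zero (Eventually.of_forall fun η => ?_) hd
  simp only [h0]
  exact (R.isAcceptProb η).nonneg _ _

omit [IsMarkovKernel κ] in
theorem deriv_eq_zero_of_eq_one {t : ℕ} (R : IsRegularChain κ a θ π D K N) (ht : t < N) :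
    ∀ᵐ p ∂(π t ⊗ₘ κ), a θ p.1 p.2 = 1 → D p = 0 := by
  filter_upwards [R.hasDerivAt t ht] with p hd h0
  refine IsLocalMax.hasDerivAt_eq_zero (Eventually.of_forall fun η => ?_) hd
  simp only [h0]
  exact (R.isAcceptProb η).le_one _ _

/-- Links the law of state and candidate at time t to the law at time t + 1; this is how an L¹
estimate under the next law reaches the accepted candidates. -/
theorem integral_mix {t : ℕ} (R : IsRegularChain κ a θ π D K N) (hm : Measurable h)
    (hC : ∀ x, |h x| ≤ C) :
    ∫ p, (h p.1 + a θ p.1 p.2 * (h p.2 - h p.1)) ∂(π t ⊗ₘ κ) = ∫ x, h x ∂(π (t + 1)) := by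
  have := R.isProbabilityMeasure t
  rw [R.integral_succ t h C hm hC, integral_acceptOp (R.isAcceptProb θ) hm hC]

/-- The `L¹` distance of iterated transitions is at most linear in the change of parameter. -/
theorem exists_integral_abs_iterate_sub_le (R : IsRegularChain κ a θ π D K N)
    (hm : Measurable h) (hC : ∀ x, |h x| ≤ C) (m : ℕ) :
    ∀ t, t + m ≤ N → ∃ B : ℝ, ∀ᶠ η in 𝓝 θ,
      ∫ x, |(acceptOp κ (a η))^[m] h x - (acceptOp κ (a θ))^[m] h x| ∂(π t) ≤ B * |η - θ| := by
  induction m with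
  | zero => exact fun t _ => ⟨0, by simp⟩
  | succ m ih =>
    intro t ht
    have := R.isProbabilityMeasure
    -- One transition uses up one time step: m iterates under π (t + 1) control m + 1 iterates under
    -- π t.
    obtain ⟨B, hB⟩ := ih (t + 1) (by omega)
    refine ⟨B + 2 * C * ∫ p, K p ∂(π t ⊗ₘ κ), ?_⟩
    filter_upwards [hB, R.lipschitz t (by omega)] with η hη hlip
    set u := (acceptOp κ (a η))^[m] h with hu
    set v := (acceptOp κ (a θ))^[m] h with hv
    have um : Measurable u := measurable_iterate_acceptOp (R.isAcceptProb η) hm m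
    have vm : Measurable v := measurable_iterate_acceptOp (R.isAcceptProb θ) hm m
    have uC : ∀ x, |u x| ≤ C := abs_iterate_acceptOp_le (R.isAcceptProb η) hC m
    have vC : ∀ x, |v x| ≤ C := abs_iterate_acceptOp_le (R.isAcceptProb θ) hC m
    have φm : Measurable fun x => |u x - v x| := (um.sub vm).abs
    have φC : ∀ x, |(|u x - v x|)| ≤ C + C := fun x => by
      rw [abs_abs]; exact (abs_sub _ _).trans (add_le_add (uC x) (vC x))
    have iu := integrable_of_abs_le (μ := π t ⊗ₘ κ) ((R.isAcceptProb η).measurable_mix um)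
      fun p => (R.isAcceptProb η).abs_mix_le uC p.1 p.2
    have iv := integrable_of_abs_le (μ := π t ⊗ₘ κ) ((R.isAcceptProb θ).measurable_mix vm)
      fun p => (R.isAcceptProb θ).abs_mix_le vC p.1 p.2
    have iφ := integrable_of_abs_le (μ := π t ⊗ₘ κ) ((R.isAcceptProb θ).measurable_mix φm)
      fun p => (R.isAcceptProb θ).abs_mix_le φC p.1 p.2
    have iK := R.integrable_bound t (by omega)
    rw [Function.iterate_succ_apply', Function.iterate_succ_apply', ← hu, ← hv]
    calc ∫ x, |acceptOp κ (a η) u x - acceptOp κ (a θ) v x| ∂(π t)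
        = ∫ x, |∫ x', ((u x + a η x x' * (u x' - u x))
            - (v x + a θ x x' * (v x' - v x))) ∂κ x| ∂(π t) := by
          congr 1
          funext x
          rw [integral_sub]
          · rfl
          · exact integrable_of_abs_le
              (((R.isAcceptProb η).measurable_mix um).comp measurable_prodMk_left)
              fun x' => (R.isAcceptProb η).abs_mix_le uC x x'
          · exact integrable_of_abs_le
              (((R.isAcceptProb θ).measurable_mix vm).comp measurable_prodMk_left)
              fun x' => (R.isAcceptProb θ).abs_mix_le vC x x'
      _ ≤ ∫ x, ∫ x', |(u x + a η x x' * (u x' - u x))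
            - (v x + a θ x x' * (v x' - v x))| ∂κ x ∂(π t) := by
          refine integral_mono_of_nonneg (ae_of_all _ fun x => abs_nonneg _)
            (iu.sub iv).abs.integral_compProd (ae_of_all _ fun x => ?_)
          exact abs_integral_le_integral_abs
      _ = ∫ p, |(u p.1 + a η p.1 p.2 * (u p.2 - u p.1))
            - (v p.1 + a θ p.1 p.2 * (v p.2 - v p.1))| ∂(π t ⊗ₘ κ) :=
          (Measure.integral_compProd (iu.sub iv).abs).symm
      _ ≤ ∫ p, ((|u p.1 - v p.1| + a θ p.1 p.2 * (|u p.2 - v p.2| - |u p.1 - v p.1|))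
            + 2 * C * |η - θ| * K p) ∂(π t ⊗ₘ κ) := by
          refine integral_mono_ae (iu.sub iv).abs (iφ.add (iK.const_mul _)) ?_
          filter_upwards [hlip] with p hp
          have h0 := (R.isAcceptProb θ).nonneg p.1 p.2
          have h1 := (R.isAcceptProb θ).le_one p.1 p.2
          -- P_η u - P_θ v = P_θ(u - v) + (P_η - P_θ)u. The first part is averaged by the θ-chain
          -- into the next law; the second costs at most 2C K |η - θ|.
          have e : (u p.1 + a η p.1 p.2 * (u p.2 - u p.1))
              - (v p.1 + a θ p.1 p.2 * (v p.2 - v p.1)) =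
              ((1 - a θ p.1 p.2) * (u p.1 - v p.1) + a θ p.1 p.2 * (u p.2 - v p.2)) +
                (a η p.1 p.2 - a θ p.1 p.2) * (u p.2 - u p.1) := by ring
          have hΔ : |u p.2 - u p.1| ≤ 2 * C :=
            (abs_sub _ _).trans (by linarith [uC p.1, uC p.2])
          have e1 : |(1 - a θ p.1 p.2) * (u p.1 - v p.1)| =
              (1 - a θ p.1 p.2) * |u p.1 - v p.1| := by
            rw [abs_mul, abs_of_nonneg (by linarith)]
          have e2 : |a θ p.1 p.2 * (u p.2 - v p.2)| = a θ p.1 p.2 * |u p.2 - v p.2| := by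
            rw [abs_mul, abs_of_nonneg h0]
          have e3 : |(a η p.1 p.2 - a θ p.1 p.2) * (u p.2 - u p.1)| ≤
              K p * |η - θ| * (2 * C) := by
            rw [abs_mul]
            exact mul_le_mul hp hΔ (abs_nonneg _) ((abs_nonneg _).trans hp)
          rw [e]
          have t1 := abs_add_le ((1 - a θ p.1 p.2) * (u p.1 - v p.1) +
            a θ p.1 p.2 * (u p.2 - v p.2)) ((a η p.1 p.2 - a θ p.1 p.2) * (u p.2 - u p.1))
          have t2 := abs_add_le ((1 - a θ p.1 p.2) * (u p.1 - v p.1))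
            (a θ p.1 p.2 * (u p.2 - v p.2))
          linarith
      _ = ∫ x, |u x - v x| ∂(π (t + 1)) + 2 * C * |η - θ| * ∫ p, K p ∂(π t ⊗ₘ κ) := by
          rw [integral_add iφ (iK.const_mul _), integral_const_mul,
            R.integral_mix φm φC]
      _ ≤ (B + 2 * C * ∫ p, K p ∂(π t ⊗ₘ κ)) * |η - θ| := by linarith

theorem tendsto_integral_abs_iterate_sub (R : IsRegularChain κ a θ π D K N)
    (hm : Measurable h) (hC : ∀ x, |h x| ≤ C) {m t : ℕ} (ht : t + m ≤ N) :
    Tendsto (fun η => ∫ x, |(acceptOp κ (a η))^[m] h x - (acceptOp κ (a θ))^[m] h x| ∂(π t))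
      (𝓝 θ) (𝓝 0) := by
  obtain ⟨B, hB⟩ := R.exists_integral_abs_iterate_sub_le hm hC m t ht
  refine squeeze_zero' (Eventually.of_forall fun η => integral_nonneg fun x => abs_nonneg _) hB ?_
  have : Tendsto (fun η : ℝ => B * |η - θ|) (𝓝 θ) (𝓝 (B * |θ - θ|)) :=
    Continuous.tendsto (by fun_prop) θ
  simpa using this

/-- The derivative of one transition, tested against bounded functions that converge in `L¹` along
the chain. -/
theorem hasDerivAt_integral_mul_sub (R : IsRegularChain κ a θ π D K N) {t : ℕ} (ht : t < N)
    {u : ℝ → X → ℝ} (um : ∀ η, Measurable (u η)) (uC : ∀ η x, |u η x| ≤ C)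
    (hu0 : Tendsto (fun η => ∫ x, |u η x - u θ x| ∂(π t)) (𝓝 θ) (𝓝 0))
    (hu1 : Tendsto (fun η => ∫ x, |u η x - u θ x| ∂(π (t + 1))) (𝓝 θ) (𝓝 0)) :
    HasDerivAt (fun η => ∫ p, (a η p.1 p.2 - a θ p.1 p.2) * (u η p.2 - u η p.1) ∂(π t ⊗ₘ κ))
      (flipIntegral κ D (π t) (u θ)) θ := by
  have := R.isProbabilityMeasure
  have iD := R.integrable_deriv ht
  have am := fun η => (R.isAcceptProb η).measurable
  have φm : ∀ η, Measurable fun x => |u η x - u θ x| := fun η => ((um η).sub (um θ)).abs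
  have φC : ∀ η x, |u η x - u θ x| ≤ C + C := fun η x =>
    (abs_sub _ _).trans (add_le_add (uC _ x) (uC _ x))
  have φC' : ∀ η x, |(|u η x - u θ x|)| ≤ C + C := fun η x => by rw [abs_abs]; exact φC η x
  have ΔC : ∀ η (p : X × X), |u η p.2 - u η p.1| ≤ C + C := fun η p =>
    (abs_sub _ _).trans (add_le_add (uC _ _) (uC _ _))
  have Δm : ∀ η, Measurable fun p : X × X => u η p.2 - u η p.1 := fun η =>
    ((um η).comp measurable_snd).sub ((um η).comp measurable_fst)
  have sm : ∀ η, Measurable fun p : X × X => slope (fun η => a η p.1 p.2) θ η := fun η => by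
    simp only [slope_def_field]
    exact ((am η).sub (am θ)).div_const _
  have hslope := R.abs_slope_le ht
  have iK := R.integrable_bound t ht
  -- the difference quotient of the acceptance probability converges in `L¹`
  have lim1 : Tendsto (fun η => ∫ p, |slope (fun η => a η p.1 p.2) θ η - D p| ∂(π t ⊗ₘ κ))
      (𝓝[≠] θ) (𝓝 0) := by
    have := tendsto_integral_filter_of_dominated_convergence (l := 𝓝[≠] θ) (μ := π t ⊗ₘ κ)
      (F := fun η p => |slope (fun η => a η p.1 p.2) θ η - D p|) (f := fun _ => (0 : ℝ))
      (fun p => K p + K p)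
      (Eventually.of_forall fun η => ((sm η).sub R.measurable_deriv).abs.aestronglyMeasurable)
      (by
        filter_upwards [hslope] with η hη
        filter_upwards [hη, R.abs_deriv_le ht] with p h1 h2
        rw [Real.norm_eq_abs, abs_abs]
        exact (abs_sub _ _).trans (add_le_add h1 h2))
      (iK.add iK)
      (by
        filter_upwards [R.hasDerivAt t ht] with p hp
        have := ((hasDerivAt_iff_tendsto_slope.1 hp).sub_const (D p)).abs
        simpa using this)
    simpa using this
  -- the test functions converge along proposals that may be accepted
  have lim2 : Tendsto (fun η => ∫ p, (|u η p.2 - u θ p.2|) * |D p| ∂(π t ⊗ₘ κ))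
      (𝓝 θ) (𝓝 0) := by
    refine tendsto_integral_mul_abs_of_weight (w := fun p : X × X => a θ p.1 p.2) (C := C + C)
      (fun η => (φm η).comp measurable_snd) (fun η p => abs_nonneg _) (fun η p => φC η _) (am θ)
      (fun p => (R.isAcceptProb θ).nonneg _ _) (fun p => (R.isAcceptProb θ).le_one _ _)
      iD (R.deriv_eq_zero_of_eq_zero ht) ?_
    refine squeeze_zero (fun η => integral_nonneg fun p =>
      mul_nonneg (abs_nonneg _) ((R.isAcceptProb θ).nonneg _ _)) (fun η => ?_) hu1
    -- Under the next law a candidate carries weight a θ and the old state weight 1 - a θ;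
    -- discarding the latter, which is nonnegative, leaves the weighted integral over candidates.
    rw [← R.integral_mix (φm η) (φC' η)]
    refine integral_mono_of_nonneg (ae_of_all _ fun p =>
      mul_nonneg (abs_nonneg _) ((R.isAcceptProb θ).nonneg _ _))
      (integrable_of_abs_le ((R.isAcceptProb θ).measurable_mix (φm η)) (C := C + C)
        fun p => (R.isAcceptProb θ).abs_mix_le (φC' η) p.1 p.2)
      (ae_of_all _ fun p => ?_)
    have h1 := (R.isAcceptProb θ).le_one p.1 p.2
    have h2 := mul_nonneg (sub_nonneg.2 h1) (abs_nonneg (u η p.1 - u θ p.1))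
    simp only
    linarith
  have lim3 : Tendsto (fun η => ∫ p, (|u η p.1 - u θ p.1|) * |D p| ∂(π t ⊗ₘ κ))
      (𝓝 θ) (𝓝 0) := by
    -- The current state already has law π t, so no vanishing condition is needed; the truncation
    -- serves only because D may be unbounded.
    refine tendsto_integral_mul_abs_of_weight (w := fun _ => 1) (C := C + C)
      (fun η => (φm η).comp measurable_fst) (fun η p => abs_nonneg _) (fun η p => φC η _)
      measurable_const (fun p => zero_le_one) (fun p => le_rfl)
      iD (ae_of_all _ fun p h => absurd h one_ne_zero) ?_
    refine hu0.congr fun η => ?_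
    simp only [mul_one]
    rw [Measure.integral_compProd (f := fun p : X × X => |u η p.1 - u θ p.1|)
      (integrable_of_abs_le ((φm η).comp measurable_fst) (C := C + C)
      fun p => by simpa using φC η p.1)]
    simp
  rw [hasDerivAt_iff_tendsto_slope, tendsto_iff_dist_tendsto_zero]
  have key : Tendsto (fun η => (C + C) *
        (∫ p, |slope (fun η => a η p.1 p.2) θ η - D p| ∂(π t ⊗ₘ κ)) +
      ((∫ p, (|u η p.2 - u θ p.2|) * |D p| ∂(π t ⊗ₘ κ)) +
        ∫ p, (|u η p.1 - u θ p.1|) * |D p| ∂(π t ⊗ₘ κ))) (𝓝[≠] θ) (𝓝 0) := by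
    have := (lim1.const_mul (C + C)).add ((lim2.mono_left nhdsWithin_le_nhds).add
      (lim3.mono_left (nhdsWithin_le_nhds (s := {θ}ᶜ))))
    simpa using this
  refine squeeze_zero' (Eventually.of_forall fun η => dist_nonneg) ?_ key
  filter_upwards [hslope] with η hη
  have is : Integrable (fun p : X × X => slope (fun η => a η p.1 p.2) θ η) (π t ⊗ₘ κ) :=
    iK.mono' (sm η).aestronglyMeasurable hη
  have bd : ∀ {F G : X × X → ℝ} {B : ℝ}, Integrable F (π t ⊗ₘ κ) → Measurable G →
      (∀ p, |G p| ≤ B) → Integrable (fun p => F p * G p) (π t ⊗ₘ κ) := fun hF hG hB =>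
    hF.mul_bdd hG.aestronglyMeasurable (ae_of_all _ hB)
  -- The function is 0 at η = θ, so its slope puts the whole difference quotient on the acceptance
  -- probability and leaves u η undifferentiated.
  have e1 : slope (fun η => ∫ p, (a η p.1 p.2 - a θ p.1 p.2) * (u η p.2 - u η p.1) ∂(π t ⊗ₘ κ))
      θ η = ∫ p, slope (fun η => a η p.1 p.2) θ η * (u η p.2 - u η p.1) ∂(π t ⊗ₘ κ) := by
    simp only [slope_def_field, sub_self, zero_mul, integral_zero, sub_zero]
    rw [← integral_div]
    congr 1
    funext p
    ring
  have iA : Integrable (fun p => |slope (fun η => a η p.1 p.2) θ η - D p|) (π t ⊗ₘ κ) :=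
    (is.sub iD).abs
  have iB : Integrable (fun p => (|u η p.2 - u θ p.2|) * |D p|) (π t ⊗ₘ κ) := by
    have := bd iD.abs ((φm η).comp measurable_snd) (B := C + C) fun p => by
      simpa using φC η p.2
    simpa [mul_comm] using this
  have iC : Integrable (fun p => (|u η p.1 - u θ p.1|) * |D p|) (π t ⊗ₘ κ) := by
    have := bd iD.abs ((φm η).comp measurable_fst) (B := C + C) fun p => by
      simpa using φC η p.1
    simpa [mul_comm] using this
  rw [e1, flipIntegral, Real.dist_eq,
    ← integral_sub (bd is (Δm η) (ΔC η)) (bd iD (Δm θ) (ΔC θ)), ← integral_const_mul,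
    ← integral_add iB iC]
  refine le_of_le_of_eq ?_ (integral_add (iA.const_mul _) (iB.add iC))
  refine abs_integral_le_integral_abs.trans (integral_mono
    ((bd is (Δm η) (ΔC η)).sub (bd iD (Δm θ) (ΔC θ))).abs ((iA.const_mul _).add (iB.add iC))
    fun p => ?_)
  have e2 : slope (fun η => a η p.1 p.2) θ η * (u η p.2 - u η p.1) - D p * (u θ p.2 - u θ p.1) =
      (u η p.2 - u η p.1) * (slope (fun η => a η p.1 p.2) θ η - D p) +
      ((u η p.2 - u θ p.2) * D p - (u η p.1 - u θ p.1) * D p) := by ring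
  beta_reduce
  rw [e2]
  refine (abs_add_le _ _).trans (add_le_add ?_ ((abs_sub _ _).trans ?_))
  · rw [abs_mul]
    exact mul_le_mul_of_nonneg_right (ΔC η p) (abs_nonneg _)
  · rw [abs_mul, abs_mul]

/-- A product rule for the m factors P_η. The outermost factor is peeled off: its variation gives
the term at time t, and freezing it at θ advances the law to π (t + 1), where induction applies. The
test function left in the term i has passed through the m - 1 - i remaining transitions. -/
theorem hasDerivAt_integral_iterate (R : IsRegularChain κ a θ π D K N)
    (hm : Measurable h) (hC : ∀ x, |h x| ≤ C) (m : ℕ) :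
    ∀ t, t + m ≤ N → HasDerivAt (fun η => ∫ x, (acceptOp κ (a η))^[m] h x ∂(π t))
      (∑ i ∈ Finset.range m,
        flipIntegral κ D (π (t + i)) ((acceptOp κ (a θ))^[m - 1 - i] h)) θ := by
  induction m with
  | zero => intro t _; simpa using hasDerivAt_const θ (∫ x, h x ∂(π t))
  | succ m ih =>
    intro t ht
    have := R.isProbabilityMeasure
    have um := fun η => measurable_iterate_acceptOp (κ := κ) (R.isAcceptProb η) hm m
    have uC := fun η => abs_iterate_acceptOp_le (κ := κ) (R.isAcceptProb η) hC m
    have h1 := R.hasDerivAt_integral_mul_sub (t := t) (by omega) um uC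
      (R.tendsto_integral_abs_iterate_sub hm hC (by omega))
      (R.tendsto_integral_abs_iterate_sub hm hC (by omega))
    -- P_η u = (P_η - P_θ)u + P_θ u with u = P_η^m h.
    have e : (fun η => ∫ x, (acceptOp κ (a η))^[m + 1] h x ∂(π t)) =
        (fun η => ∫ p, (a η p.1 p.2 - a θ p.1 p.2) * ((acceptOp κ (a η))^[m] h p.2 -
          (acceptOp κ (a η))^[m] h p.1) ∂(π t ⊗ₘ κ)) +
        fun η => ∫ x, (acceptOp κ (a η))^[m] h x ∂(π (t + 1)) := by
      funext η
      rw [Function.iterate_succ_apply', integral_acceptOp (R.isAcceptProb η) (um η) (uC η),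
        Pi.add_apply, ← R.integral_mix (um η) (uC η), ← integral_add]
      · congr 1
        funext p
        ring
      · refine integrable_of_abs_le (C := 1 * (C + C)) ?_ fun p => ?_
        · have := (R.isAcceptProb η).measurable
          have := (R.isAcceptProb θ).measurable
          have := um η
          fun_prop
        · rw [abs_mul]
          have := (R.isAcceptProb η).nonneg p.1 p.2
          have := (R.isAcceptProb η).le_one p.1 p.2
          have := (R.isAcceptProb θ).nonneg p.1 p.2
          have := (R.isAcceptProb θ).le_one p.1 p.2
          exact mul_le_mul (abs_le.2 ⟨by linarith, by linarith⟩)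
            ((abs_sub _ _).trans (add_le_add (uC _ _) (uC _ _))) (abs_nonneg _) zero_le_one
      · exact integrable_of_abs_le ((R.isAcceptProb θ).measurable_mix (um η))
          fun p => (R.isAcceptProb θ).abs_mix_le (uC η) p.1 p.2
    have s : ∑ i ∈ Finset.range (m + 1),
          flipIntegral κ D (π (t + i)) ((acceptOp κ (a θ))^[m + 1 - 1 - i] h) =
        flipIntegral κ D (π t) ((acceptOp κ (a θ))^[m] h) + ∑ i ∈ Finset.range m,
          flipIntegral κ D (π (t + 1 + i)) ((acceptOp κ (a θ))^[m - 1 - i] h) := by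
      rw [Finset.sum_range_succ', add_comm]
      congr 1
      refine Finset.sum_congr rfl fun i hi => ?_
      rw [show t + (i + 1) = t + 1 + i by ring, show m + 1 - 1 - (i + 1) = m - 1 - i by omega]
    rw [e, s]
    exact h1.add (ih (t + 1) (by omega))

end IsRegularChain

end DiffMH

/-! ### One iteration of the loop: averaging over the uniform numbers and the candidates -/

namespace DiffMH

variable {X : Type*} [MeasurableSpace X]

section Step

theorem measurable_acceptReject {a : X → X → ℝ} (ha : Measurable fun p : X × X => a p.1 p.2) :
    Measurable fun p : (X × X) × I => acceptReject a p.1.1 p.1.2 p.2 :=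
  Measurable.ite (measurableSet_le (by fun_prop) (ha.comp measurable_fst)) (by fun_prop)
    (by fun_prop)

theorem measurable_flipWeight {a da : X → X → ℝ} (ha : Measurable fun p : X × X => a p.1 p.2)
    (hda : Measurable fun p : X × X => da p.1 p.2) :
    Measurable fun p : (X × X) × I => flipWeight a da p.1.1 p.1.2 p.2 :=
  Measurable.ite (measurableSet_le (by fun_prop) (ha.comp measurable_fst)) (by fun_prop)
    (by fun_prop)

theorem flipWeight_nonneg {a : X → X → ℝ} (ha : IsAcceptProb a) (da : X → X → ℝ) (x x' : X)
    (u : I) : 0 ≤ flipWeight a da x x' u := by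
  have h0 := ha.nonneg x x'
  have h1 := sub_nonneg.2 (ha.le_one x x')
  unfold flipWeight
  split_ifs <;> positivity

open Classical in
/-- The state of the alternative that is created by flipping the accept/reject decision. -/
noncomputable def flipState (a : X → X → ℝ) (x x' : X) (u : I) : X :=
  if (u : ℝ) ≤ a x x' then x else x'

theorem measurable_flipState {a : X → X → ℝ} (ha : Measurable fun p : X × X => a p.1 p.2) :
    Measurable fun p : (X × X) × I => flipState a p.1.1 p.1.2 p.2 :=
  Measurable.ite (measurableSet_le (by fun_prop) (ha.comp measurable_fst)) (by fun_prop)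
    (by fun_prop)

open Classical in
/-- The weight of the current alternative after dropping it if it has recoupled. -/
noncomputable def keptWeight (a : X → X → ℝ) (s : DState X) (c : X × X) (u : I) : ℝ :=
  if acceptReject a s.2.1 c.2 u = acceptReject a s.1 c.1 u then 0 else s.2.2.1

theorem measurable_keptWeight [MeasurableEq X] {a : X → X → ℝ}
    (ha : Measurable fun p : X × X => a p.1 p.2) :
    Measurable fun p : (DState X × (X × X)) × I => keptWeight a p.1.1 p.1.2 p.2 := by
  refine Measurable.ite (measurableSet_eq_fun ?_ ?_) (by fun_prop) (by fun_prop)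
  · exact (measurable_acceptReject ha).comp
      (f := fun p : (DState X × (X × X)) × I => ((p.1.1.2.1, p.1.2.2), p.2)) (by fun_prop)
  · exact (measurable_acceptReject ha).comp
      (f := fun p : (DState X × (X × X)) × I => ((p.1.1.1, p.1.2.1), p.2)) (by fun_prop)

omit [MeasurableSpace X] in
theorem abs_keptWeight_le (a : X → X → ℝ) (s : DState X) (c : X × X) (u : I) :
    |keptWeight a s c u| ≤ |s.2.2.1| := by
  unfold keptWeight
  split_ifs <;> simp

omit [MeasurableSpace X] in
theorem keptWeight_nonneg (a : X → X → ℝ) {s : DState X} (hs : 0 ≤ s.2.2.1) (c : X × X) (u : I) :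
    0 ≤ keptWeight a s c u := by
  unfold keptWeight
  split_ifs <;> simp [hs]

omit [MeasurableSpace X] in
-- Dropping a recoupled alternative costs nothing, because the difference multiplied by its weight
-- is then 0.
theorem keptWeight_mul_sub (a : X → X → ℝ) (s : DState X) (c : X × X) (u : I) (h : X → ℝ) :
    keptWeight a s c u * (h (acceptReject a s.2.1 c.2 u) - h (acceptReject a s.1 c.1 u)) =
      s.2.2.1 * (h (acceptReject a s.2.1 c.2 u) - h (acceptReject a s.1 c.1 u)) := by
  unfold keptWeight
  split_ifs with h
  · simp [h]
  · rfl

open Classical in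
omit [MeasurableSpace X] in
theorem dmhStep_eq (a da : X → X → ℝ) (f : X → ℝ) (s : DState X) (c : X × X) (u v : I) :
    dmhStep a da f s (c, u, v) =
      (acceptReject a s.1 c.1 u,
        (if (v : ℝ) * (flipWeight a da s.1 c.1 u + keptWeight a s c u) < flipWeight a da s.1 c.1 u
          then flipState a s.1 c.1 u else acceptReject a s.2.1 c.2 u),
        flipWeight a da s.1 c.1 u + keptWeight a s c u,
        s.2.2.2 + (flipWeight a da s.1 c.1 u + keptWeight a s c u) *
          (f (if (v : ℝ) * (flipWeight a da s.1 c.1 u + keptWeight a s c u) <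
            flipWeight a da s.1 c.1 u then flipState a s.1 c.1 u
            else acceptReject a s.2.1 c.2 u) - f (acceptReject a s.1 c.1 u))) :=
  rfl

theorem measurable_dmhStep [MeasurableEq X] {a da : X → X → ℝ} {f : X → ℝ}
    (ha : Measurable fun p : X × X => a p.1 p.2) (hda : Measurable fun p : X × X => da p.1 p.2)
    (hf : Measurable f) :
    Measurable fun p : DState X × DNoise X => dmhStep a da f p.1 p.2 := by
  classical
  have h1 : Measurable fun p : DState X × DNoise X => acceptReject a p.1.1 p.2.1.1 p.2.2.1 :=
    (measurable_acceptReject ha).comp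
      (f := fun p : DState X × DNoise X => ((p.1.1, p.2.1.1), p.2.2.1)) (by fun_prop)
  have h2 : Measurable fun p : DState X × DNoise X => acceptReject a p.1.2.1 p.2.1.2 p.2.2.1 :=
    (measurable_acceptReject ha).comp
      (f := fun p : DState X × DNoise X => ((p.1.2.1, p.2.1.2), p.2.2.1)) (by fun_prop)
  have h3 : Measurable fun p : DState X × DNoise X => flipWeight a da p.1.1 p.2.1.1 p.2.2.1 :=
    (measurable_flipWeight ha hda).comp
      (f := fun p : DState X × DNoise X => ((p.1.1, p.2.1.1), p.2.2.1)) (by fun_prop)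
  have h4 : Measurable fun p : DState X × DNoise X => flipState a p.1.1 p.2.1.1 p.2.2.1 :=
    (measurable_flipState ha).comp
      (f := fun p : DState X × DNoise X => ((p.1.1, p.2.1.1), p.2.2.1)) (by fun_prop)
  have h5 : Measurable fun p : DState X × DNoise X => keptWeight a p.1 p.2.1 p.2.2.1 :=
    (measurable_keptWeight ha).comp
      (f := fun p : DState X × DNoise X => ((p.1, p.2.1), p.2.2.1)) (by fun_prop)
  have h6 : Measurable fun p : DState X × DNoise X =>
      if (p.2.2.2 : ℝ) * (flipWeight a da p.1.1 p.2.1.1 p.2.2.1 + keptWeight a p.1 p.2.1 p.2.2.1) <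
        flipWeight a da p.1.1 p.2.1.1 p.2.2.1 then flipState a p.1.1 p.2.1.1 p.2.2.1
        else acceptReject a p.1.2.1 p.2.1.2 p.2.2.1 :=
    Measurable.ite (measurableSet_lt (by fun_prop) h3) h4 h2
  have h7 := hf.comp h6
  have h8 := hf.comp h1
  exact h1.prodMk (h6.prodMk ((h3.add h5).prodMk
    ((by fun_prop : Measurable fun p : DState X × DNoise X => p.1.2.2.2).add
      ((h3.add h5).mul (h7.sub h8)))))

/-- The choice between the new and the current alternative is unbiased. -/
theorem integral_prune {A B : ℝ} (hA : 0 ≤ A) (hB : 0 ≤ B) (p q c : ℝ) :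
    ∫ v : I, (A + B) * ((if (v : ℝ) * (A + B) < A then p else q) - c) =
      A * (p - c) + B * (q - c) := by
  -- If the total weight is 0 both sides vanish; otherwise the new alternative is chosen with
  -- probability A / (A + B), and the factor A + B cancels the denominator.
  rcases (add_nonneg hA hB).eq_or_lt with h | h
  · have hA0 : A = 0 := by linarith
    have hB0 : B = 0 := by linarith
    simp [hA0, hB0]
  · have e : ∀ v : I, (A + B) * ((if (v : ℝ) * (A + B) < A then p else q) - c) =
        if (v : ℝ) < A / (A + B) then (A + B) * (p - c) else (A + B) * (q - c) := fun v => by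
      simp only [lt_div_iff₀ h]
      split_ifs <;> rfl
    simp only [e]
    rw [integral_ite_lt_unitInterval (div_nonneg hA h.le) ((div_le_one h).2 (by linarith))]
    field_simp
    ring

variable {a : X → X → ℝ}

theorem integral_acceptReject (ha : IsAcceptProb a) (h : X → ℝ) (x x' : X) :
    ∫ u, h (acceptReject a x x' u) = h x + a x x' * (h x' - h x) := by
  have : ∀ u : I, h (acceptReject a x x' u) = if (u : ℝ) ≤ a x x' then h x' else h x := fun u => by
    unfold acceptReject
    split_ifs <;> rfl
  simp only [this]
  exact integral_ite_le_unitInterval (ha.nonneg _ _) (ha.le_one _ _) _ _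

/-- The weights divide by the probabilities of acceptance and rejection, which cancel on averaging
over u. The negative part of the derivative then multiplies h x - h x' and the positive part h x' -
h x, and they combine to the derivative itself. The hypotheses `h0` and `h1` cover the cases where
the inverse takes its default value 0. -/
theorem integral_flipWeight_mul (ha : IsAcceptProb a) {da : X → X → ℝ} {x x' : X}
    (h0 : a x x' = 0 → da x x' = 0) (h1 : a x x' = 1 → da x x' = 0) (h : X → ℝ) :
    ∫ u, flipWeight a da x x' u * (h (flipState a x x' u) - h (acceptReject a x x' u)) =
      da x x' * (h x' - h x) := by
  have e : ∀ u : I, flipWeight a da x x' u *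
      (h (flipState a x x' u) - h (acceptReject a x x' u)) =
      if (u : ℝ) ≤ a x x' then (a x x')⁻¹ * max 0 (-(da x x')) * (h x - h x')
      else (1 - a x x')⁻¹ * max 0 (da x x') * (h x' - h x) := fun u => by
    unfold flipWeight flipState acceptReject
    split_ifs <;> rfl
  simp only [e]
  rw [integral_ite_le_unitInterval (ha.nonneg _ _) (ha.le_one _ _)]
  by_cases hd : da x x' = 0
  · simp [hd]
  · have n0 : a x x' ≠ 0 := fun h => hd (h0 h)
    have n1 : 1 - a x x' ≠ 0 := fun h => hd (h1 (by linarith))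
    have hmax : max 0 (da x x') - max 0 (-(da x x')) = da x x' := by
      rcases le_total 0 (da x x') with h | h
      · rw [max_eq_right h, max_eq_left (by linarith)]; ring
      · rw [max_eq_left h, max_eq_right (by linarith)]; ring
    calc _ = ((1 - a x x') * (1 - a x x')⁻¹ * max 0 (da x x') -
          (a x x' * (a x x')⁻¹) * max 0 (-(da x x'))) * (h x' - h x) := by ring
      _ = _ := by rw [mul_inv_cancel₀ n0, mul_inv_cancel₀ n1, one_mul, one_mul, hmax]

/-- Here positive and negative parts add up instead of cancelling; the value |da| is what makes the
weight integrable over state and candidate. -/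
theorem integral_flipWeight (ha : IsAcceptProb a) {da : X → X → ℝ} {x x' : X}
    (h0 : a x x' = 0 → da x x' = 0) (h1 : a x x' = 1 → da x x' = 0) :
    ∫ u, flipWeight a da x x' u = |da x x'| := by
  unfold flipWeight
  rw [integral_ite_le_unitInterval (ha.nonneg _ _) (ha.le_one _ _)]
  by_cases hd : da x x' = 0
  · simp [hd]
  · have n0 : a x x' ≠ 0 := fun h => hd (h0 h)
    have n1 : 1 - a x x' ≠ 0 := fun h => hd (h1 (by linarith))
    have hmax : max 0 (da x x') + max 0 (-(da x x')) = |da x x'| := by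
      rcases le_total 0 (da x x') with h | h
      · rw [max_eq_right h, max_eq_left (by linarith), abs_of_nonneg h]; ring
      · rw [max_eq_left h, max_eq_right (by linarith), abs_of_nonpos h]; ring
    calc _ = (1 - a x x') * (1 - a x x')⁻¹ * max 0 (da x x') +
          (a x x' * (a x x')⁻¹) * max 0 (-(da x x')) := by ring
      _ = _ := by rw [mul_inv_cancel₀ n0, mul_inv_cancel₀ n1, one_mul, one_mul, hmax]

omit [MeasurableSpace X] in
theorem integrable_flipWeight {da : X → X → ℝ} (x x' : X) :
    Integrable (flipWeight a da x x') (volume : Measure I) := by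
  refine integrable_of_abs_le (C := max |(a x x')⁻¹ * max 0 (-(da x x'))|
    |(1 - a x x')⁻¹ * max 0 (da x x')|) ?_ fun u => ?_
  · exact Measurable.ite (measurableSet_le (by fun_prop) (by fun_prop)) (by fun_prop) (by fun_prop)
  · unfold flipWeight
    split_ifs
    · exact le_max_left _ _
    · exact le_max_right _ _

end Step

section Noise

variable {κ : Kernel X X} [IsMarkovKernel κ] {qxy : Kernel (X × X) (X × X)} [IsMarkovKernel qxy]
  {L : Measure (DState X)} [IsProbabilityMeasure L]

/-- The joint law of the variables of the algorithm and of the pair of candidates. -/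
noncomputable def candidateLaw (qxy : Kernel (X × X) (X × X)) (L : Measure (DState X)) :
    Measure (DState X × (X × X)) :=
  L ⊗ₘ qxy.comap (fun s : DState X => (s.1, s.2.1))
    (measurable_fst.prodMk (measurable_fst.comp measurable_snd))

instance : IsProbabilityMeasure (candidateLaw qxy L) := by
  unfold candidateLaw; infer_instance

/-- The uniform numbers do not depend on the state, so they split off as product factors and can be
integrated out one at a time, the pruning variable first. -/
theorem compProd_noiseKernel (qxy : Kernel (X × X) (X × X)) [IsMarkovKernel qxy]
    (L : Measure (DState X)) [IsProbabilityMeasure L] :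
    L ⊗ₘ noiseKernel qxy =
      (((candidateLaw qxy L).prod (volume : Measure I)).prod (volume : Measure I)).map
        (fun r => (r.1.1.1, (r.1.1.2, r.1.2, r.2))) := by
  have : IsMarkovKernel (noiseKernel qxy) := by unfold noiseKernel; infer_instance
  refine Measure.ext_of_lintegral _ fun F hF => ?_
  have hm : Measurable fun r : ((DState X × (X × X)) × I) × I =>
      (r.1.1.1, (r.1.1.2, r.1.2, r.2)) := by fun_prop
  have hG : Measurable fun r : ((DState X × (X × X)) × I) × I =>
      F (r.1.1.1, (r.1.1.2, r.1.2, r.2)) := hF.comp hm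
  have hG' := hG.lintegral_prod_right' (ν := (volume : Measure I))
  rw [lintegral_map hF hm, Measure.lintegral_compProd hF, lintegral_prod _ hG.aemeasurable,
    lintegral_prod _ hG'.aemeasurable, candidateLaw, noiseKernel,
    Measure.lintegral_compProd (hG'.lintegral_prod_right' (ν := (volume : Measure I)))]
  congr 1
  funext s
  rw [Kernel.lintegral_prod _ _ _ (by fun_prop)]
  congr 1
  funext c
  rw [Kernel.const_apply, lintegral_prod _ (by fun_prop)]

theorem measurePreserving_candidateLaw_fst :
    MeasurePreserving (fun r : DState X × (X × X) => r.1) (candidateLaw qxy L) L :=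
  ⟨measurable_fst, Measure.fst_compProd _ _⟩

/-- The first marginal of the coupling depends on x only, so the primal chain and its candidate
behave as if there were no alternative. -/
theorem measurePreserving_candidateLaw_primal
    (hfst : ∀ x y, (qxy (x, y)).map Prod.fst = κ x) :
    MeasurePreserving (fun r : DState X × (X × X) => (r.1.1, r.2.1)) (candidateLaw qxy L)
      (L.map Prod.fst ⊗ₘ κ) := by
  have : IsProbabilityMeasure (L.map Prod.fst) :=
    Measure.isProbabilityMeasure_map measurable_fst.aemeasurable
  refine ⟨by fun_prop, Measure.ext_of_lintegral _ fun F hF => ?_⟩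
  rw [lintegral_map hF (by fun_prop), candidateLaw, Measure.lintegral_compProd (by fun_prop),
    Measure.lintegral_compProd hF, lintegral_map hF.lintegral_kernel_prod_right' measurable_fst]
  congr 1
  funext s
  rw [Kernel.comap_apply, ← hfst s.1 s.2.1, lintegral_map (by fun_prop) measurable_fst]

omit [IsMarkovKernel κ] in
-- The weight is fixed before the candidates are drawn, and the bracket is a difference of a
-- function of y' and a function of x'. By linearity only the two marginals of the coupling enter.
theorem integral_candidateLaw_alternative (hfst : ∀ x y, (qxy (x, y)).map Prod.fst = κ x)
    (hsnd : ∀ x y, (qxy (x, y)).map Prod.snd = κ y) {a : X → X → ℝ} (ha : IsAcceptProb a)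
    {h : X → ℝ} {C : ℝ} (hm : Measurable h) (hC : ∀ x, |h x| ≤ C)
    (hw : Integrable (fun s : DState X => s.2.2.1) L) :
    ∫ r, r.1.2.2.1 * ((h r.1.2.1 + a r.1.2.1 r.2.2 * (h r.2.2 - h r.1.2.1)) -
        (h r.1.1 + a r.1.1 r.2.1 * (h r.2.1 - h r.1.1))) ∂(candidateLaw qxy L) =
      ∫ s, s.2.2.1 * (acceptOp κ a h s.2.1 - acceptOp κ a h s.1) ∂L := by
  have m := ha.measurable_mix hm
  have m1 : Measurable fun r : DState X × (X × X) =>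
      h r.1.2.1 + a r.1.2.1 r.2.2 * (h r.2.2 - h r.1.2.1) :=
    m.comp (f := fun r : DState X × (X × X) => (r.1.2.1, r.2.2)) (by fun_prop)
  have m2 : Measurable fun r : DState X × (X × X) =>
      h r.1.1 + a r.1.1 r.2.1 * (h r.2.1 - h r.1.1) :=
    m.comp (f := fun r : DState X × (X × X) => (r.1.1, r.2.1)) (by fun_prop)
  have i : Integrable (fun r : DState X × (X × X) => r.1.2.2.1 *
      ((h r.1.2.1 + a r.1.2.1 r.2.2 * (h r.2.2 - h r.1.2.1)) -
        (h r.1.1 + a r.1.1 r.2.1 * (h r.2.1 - h r.1.1)))) (candidateLaw qxy L) :=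
    (measurePreserving_candidateLaw_fst.integrable_comp_of_integrable hw).mul_bdd (c := C + C)
      (m1.sub m2).aestronglyMeasurable (ae_of_all _ fun r =>
        (abs_sub _ _).trans (add_le_add (ha.abs_mix_le hC _ _) (ha.abs_mix_le hC _ _)))
  rw [candidateLaw] at i ⊢
  rw [Measure.integral_compProd i]
  congr 1
  funext s
  simp only [Kernel.comap_apply]
  have mm : ∀ x, Measurable fun x' => h x + a x x' * (h x' - h x) := fun x =>
    m.comp measurable_prodMk_left
  have i1 : Integrable (fun c : X × X => h s.2.1 + a s.2.1 c.2 * (h c.2 - h s.2.1))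
      (qxy (s.1, s.2.1)) :=
    integrable_of_abs_le ((mm _).comp measurable_snd) fun r => ha.abs_mix_le hC s.2.1 r.2
  have i2 : Integrable (fun c : X × X => h s.1 + a s.1 c.1 * (h c.1 - h s.1))
      (qxy (s.1, s.2.1)) :=
    integrable_of_abs_le ((mm _).comp measurable_fst) fun r => ha.abs_mix_le hC s.1 r.1
  rw [integral_const_mul, integral_sub i1 i2]
  unfold acceptOp
  rw [← hsnd s.1 s.2.1, integral_map measurable_snd.aemeasurable (mm _).aestronglyMeasurable,
    ← hfst s.1 s.2.1, integral_map measurable_fst.aemeasurable (mm _).aestronglyMeasurable]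

end Noise

end DiffMH

/-! ### Recursion for the alternative and preservation of the loop invariants -/

namespace DiffMH

variable {X : Type*} [MeasurableSpace X]

/-- The law of the variables after one more iteration of the loop. -/
noncomputable def nextLaw (a da : X → X → ℝ) (f : X → ℝ) (qxy : Kernel (X × X) (X × X))
    (L : Measure (DState X)) : Measure (DState X) :=
  (L ⊗ₘ noiseKernel qxy).map (fun p => dmhStep a da f p.1 p.2)

/-- The invariants of the loop: the primal state has law `π`, the weight is nonnegative and
integrable, and the derivative estimate is integrable. -/
structure IsLoopLaw (π : Measure X) (L : Measure (DState X)) : Prop where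
  isProbabilityMeasure : IsProbabilityMeasure L
  map_fst : L.map Prod.fst = π
  weight_nonneg : ∀ᵐ s ∂L, 0 ≤ s.2.2.1
  integrable_weight : Integrable (fun s => s.2.2.1) L
  integrable_sum : Integrable (fun s => s.2.2.2) L

/-- The weighted difference of a test function between the alternative and the primal state. -/
noncomputable def alternativeIntegral (L : Measure (DState X)) (h : X → ℝ) : ℝ :=
  ∫ s, s.2.2.1 * (h s.2.1 - h s.1) ∂L

theorem measurable_weight : Measurable fun s : DState X => s.2.2.1 := by fun_prop

theorem measurable_sum : Measurable fun s : DState X => s.2.2.2 := by fun_prop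

section NextLaw

variable [MeasurableEq X] {κ : Kernel X X} [IsMarkovKernel κ] {qxy : Kernel (X × X) (X × X)}
  [IsMarkovKernel qxy] {L : Measure (DState X)} {π : Measure X} {a da : X → X → ℝ} {f h : X → ℝ}
  {C : ℝ}

theorem nextLaw_eq_map [IsProbabilityMeasure L] (ha : Measurable fun p : X × X => a p.1 p.2)
    (hda : Measurable fun p : X × X => da p.1 p.2) (hf : Measurable f) :
    nextLaw a da f qxy L =
      (((candidateLaw qxy L).prod (volume : Measure I)).prod (volume : Measure I)).map
        (fun r => dmhStep a da f r.1.1.1 (r.1.1.2, r.1.2, r.2)) := by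
  rw [nextLaw, compProd_noiseKernel, Measure.map_map (measurable_dmhStep ha hda hf) (by fun_prop)]
  rfl

omit [MeasurableEq X] in
theorem integrable_flipWeight_candidateLaw [IsProbabilityMeasure L] (ha : IsAcceptProb a)
    (hda : Measurable fun p : X × X => da p.1 p.2)
    (hfst : ∀ x y, (qxy (x, y)).map Prod.fst = κ x)
    (hD : Integrable (fun p : X × X => da p.1 p.2) (L.map Prod.fst ⊗ₘ κ))
    (hD0 : ∀ᵐ p ∂(L.map Prod.fst ⊗ₘ κ), a p.1 p.2 = 0 → da p.1 p.2 = 0)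
    (hD1 : ∀ᵐ p ∂(L.map Prod.fst ⊗ₘ κ), a p.1 p.2 = 1 → da p.1 p.2 = 0) :
    Integrable (fun z : (DState X × (X × X)) × I => flipWeight a da z.1.1.1 z.1.2.1 z.2)
      ((candidateLaw qxy L).prod volume) := by
  have mp := measurePreserving_candidateLaw_primal (L := L) hfst
  have hm : Measurable fun z : (DState X × (X × X)) × I =>
      flipWeight a da z.1.1.1 z.1.2.1 z.2 :=
    (measurable_flipWeight ha.measurable hda).comp
      (f := fun z : (DState X × (X × X)) × I => ((z.1.1.1, z.1.2.1), z.2)) (by fun_prop)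
  rw [integrable_prod_iff hm.aestronglyMeasurable]
  refine ⟨ae_of_all _ fun r => integrable_flipWeight (a := a) (da := da) r.1.1 r.2.1, ?_⟩
  refine (mp.integrable_comp_of_integrable hD.abs).congr ?_
  filter_upwards [mp.quasiMeasurePreserving.ae hD0, mp.quasiMeasurePreserving.ae hD1]
    with r h0 h1
  rw [Function.comp_apply, ← integral_flipWeight ha h0 h1]
  refine integral_congr_ae (ae_of_all _ fun u => ?_)
  exact (abs_of_nonneg (flipWeight_nonneg ha da _ _ _)).symm

/-- The central recursion, obtained by averaging over the pruning variable, then over u, then over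
the candidates. The kept alternative and the primal state each transform h by the transition
operator; the newly created alternative yields the derivative of one transition. -/
theorem alternativeIntegral_nextLaw (H : IsLoopLaw π L) (ha : IsAcceptProb a)
    (hda : Measurable fun p : X × X => da p.1 p.2) (hf : Measurable f)
    (hfst : ∀ x y, (qxy (x, y)).map Prod.fst = κ x)
    (hsnd : ∀ x y, (qxy (x, y)).map Prod.snd = κ y)
    (hD : Integrable (fun p : X × X => da p.1 p.2) (π ⊗ₘ κ))
    (hD0 : ∀ᵐ p ∂(π ⊗ₘ κ), a p.1 p.2 = 0 → da p.1 p.2 = 0)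
    (hD1 : ∀ᵐ p ∂(π ⊗ₘ κ), a p.1 p.2 = 1 → da p.1 p.2 = 0)
    (hm : Measurable h) (hC : ∀ x, |h x| ≤ C) :
    Integrable (fun s => s.2.2.1) (nextLaw a da f qxy L) ∧
    alternativeIntegral (nextLaw a da f qxy L) h =
      alternativeIntegral L (acceptOp κ a h) + flipIntegral κ (fun p => da p.1 p.2) π h := by
  classical
  have := H.isProbabilityMeasure
  obtain rfl := H.map_fst
  have mp := measurePreserving_candidateLaw_primal (L := L) hfst
  have mpL := measurePreserving_candidateLaw_fst (L := L) (qxy := qxy)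
  have am := ha.measurable
  have mst : Measurable fun r : ((DState X × (X × X)) × I) × I =>
      dmhStep a da f r.1.1.1 (r.1.1.2, r.1.2, r.2) :=
    (measurable_dmhStep am hda hf).comp
      (f := fun r : ((DState X × (X × X)) × I) × I => (r.1.1.1, (r.1.1.2, r.1.2, r.2)))
      (by fun_prop)
  set Q := candidateLaw qxy L with hQ
  set A : (DState X × (X × X)) × I → ℝ := fun z => flipWeight a da z.1.1.1 z.1.2.1 z.2 with hA
  set B : (DState X × (X × X)) × I → ℝ := fun z => keptWeight a z.1.1 z.1.2 z.2 with hB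
  have iA : Integrable A (Q.prod volume) :=
    integrable_flipWeight_candidateLaw ha hda hfst hD hD0 hD1
  have iwQ : Integrable (fun r : DState X × (X × X) => r.1.2.2.1) Q :=
    mpL.integrable_comp_of_integrable H.integrable_weight
  have iw : Integrable (fun z : (DState X × (X × X)) × I => z.1.1.2.2.1) (Q.prod volume) :=
    (measurePreserving_fst (μ := Q) (ν := (volume : Measure I))).integrable_comp_of_integrable iwQ
  have iB : Integrable B (Q.prod volume) :=
    iw.mono (measurable_keptWeight am).aestronglyMeasurable
      (ae_of_all _ fun z => abs_keptWeight_le a _ _ _)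
  have iAB : Integrable (fun r : ((DState X × (X × X)) × I) × I => A r.1 + B r.1)
      ((Q.prod volume).prod volume) :=
    (measurePreserving_fst (μ := Q.prod volume)
      (ν := (volume : Measure I))).integrable_comp_of_integrable (iA.add iB)
  have hnext := nextLaw_eq_map (qxy := qxy) (L := L) am hda hf
  have mx : Measurable fun z : (DState X × (X × X)) × I => acceptReject a z.1.1.1 z.1.2.1 z.2 :=
    (measurable_acceptReject am).comp
      (f := fun z : (DState X × (X × X)) × I => ((z.1.1.1, z.1.2.1), z.2)) (by fun_prop)
  have my : Measurable fun z : (DState X × (X × X)) × I => acceptReject a z.1.1.2.1 z.1.2.2 z.2 :=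
    (measurable_acceptReject am).comp
      (f := fun z : (DState X × (X × X)) × I => ((z.1.1.2.1, z.1.2.2), z.2)) (by fun_prop)
  have mf : Measurable fun z : (DState X × (X × X)) × I => flipState a z.1.1.1 z.1.2.1 z.2 :=
    (measurable_flipState am).comp
      (f := fun z : (DState X × (X × X)) × I => ((z.1.1.1, z.1.2.1), z.2)) (by fun_prop)
  have iF : Integrable (fun z : (DState X × (X × X)) × I => A z *
      (h (flipState a z.1.1.1 z.1.2.1 z.2) - h (acceptReject a z.1.1.1 z.1.2.1 z.2)))
      (Q.prod volume) :=
    iA.mul_bdd (c := C + C) ((hm.comp mf).sub (hm.comp mx)).aestronglyMeasurable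
      (ae_of_all _ fun z => (abs_sub _ _).trans (add_le_add (hC _) (hC _)))
  have iG : Integrable (fun z : (DState X × (X × X)) × I => z.1.1.2.2.1 *
      (h (acceptReject a z.1.1.2.1 z.1.2.2 z.2) - h (acceptReject a z.1.1.1 z.1.2.1 z.2)))
      (Q.prod volume) :=
    iw.mul_bdd (c := C + C) ((hm.comp my).sub (hm.comp mx)).aestronglyMeasurable
      (ae_of_all _ fun z => (abs_sub _ _).trans (add_le_add (hC _) (hC _)))
  have mΦ : Measurable fun s : DState X => h s.2.1 - h s.1 := by fun_prop
  have iN : Integrable (fun s : DState X => s.2.2.1) (nextLaw a da f qxy L) := by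
    rw [hnext, integrable_map_measure measurable_weight.aestronglyMeasurable mst.aemeasurable]
    exact iAB
  refine ⟨iN, ?_⟩
  have iΦ : Integrable (fun s : DState X => s.2.2.1 * (h s.2.1 - h s.1))
      (nextLaw a da f qxy L) :=
    iN.mul_bdd (c := C + C) mΦ.aestronglyMeasurable
      (ae_of_all _ fun z => (abs_sub _ _).trans (add_le_add (hC _) (hC _)))
  rw [hnext] at iΦ
  have iΦ' := (integrable_map_measure iΦ.aestronglyMeasurable mst.aemeasurable).1 iΦ
  have hw : ∀ᵐ z ∂(Q.prod (volume : Measure I)), 0 ≤ z.1.1.2.2.1 :=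
    (mpL.comp (measurePreserving_fst (μ := Q)
      (ν := (volume : Measure I)))).quasiMeasurePreserving.ae H.weight_nonneg
  calc alternativeIntegral (nextLaw a da f qxy L) h
      = ∫ r, ((fun s : DState X => s.2.2.1 * (h s.2.1 - h s.1)) ∘
          fun r : ((DState X × (X × X)) × I) × I =>
            dmhStep a da f r.1.1.1 (r.1.1.2, r.1.2, r.2)) r ∂((Q.prod volume).prod volume) := by
        rw [alternativeIntegral, hnext, integral_map mst.aemeasurable iΦ.aestronglyMeasurable]
        rfl
    _ = ∫ z, (∫ v : I, (A z + B z) * ((if (v : ℝ) * (A z + B z) < A z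
          then h (flipState a z.1.1.1 z.1.2.1 z.2)
          else h (acceptReject a z.1.1.2.1 z.1.2.2 z.2)) -
            h (acceptReject a z.1.1.1 z.1.2.1 z.2))) ∂(Q.prod volume) := by
        rw [integral_prod _ iΦ']
        simp only [Function.comp_apply, dmhStep_eq, apply_ite h]
        rfl
    _ = ∫ z, (A z * (h (flipState a z.1.1.1 z.1.2.1 z.2) -
            h (acceptReject a z.1.1.1 z.1.2.1 z.2)) +
          z.1.1.2.2.1 * (h (acceptReject a z.1.1.2.1 z.1.2.2 z.2) -
            h (acceptReject a z.1.1.1 z.1.2.1 z.2))) ∂(Q.prod volume) := by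
        -- Unbiased pruning needs nonnegative weights, which the invariant gives almost surely. The
        -- kept weight may then be replaced by the old one.
        refine integral_congr_ae ?_
        filter_upwards [hw] with z hz
        rw [integral_prune (flipWeight_nonneg ha da _ _ _) (keptWeight_nonneg a hz _ _),
          keptWeight_mul_sub]
    _ = (∫ r, da r.1.1 r.2.1 * (h r.2.1 - h r.1.1) ∂Q) +
        ∫ r, r.1.2.2.1 * ((h r.1.2.1 + a r.1.2.1 r.2.2 * (h r.2.2 - h r.1.2.1)) -
          (h r.1.1 + a r.1.1 r.2.1 * (h r.2.1 - h r.1.1))) ∂Q := by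
        rw [integral_add iF iG, integral_prod _ iF, integral_prod _ iG]
        congr 1
        · refine integral_congr_ae ?_
          filter_upwards [mp.quasiMeasurePreserving.ae hD0, mp.quasiMeasurePreserving.ae hD1]
            with r h0 h1
          exact integral_flipWeight_mul ha h0 h1 h
        · congr 1
          funext r
          have j : ∀ x x', Integrable (fun u : I => h (acceptReject a x x' u)) volume :=
            fun x x' => integrable_of_abs_le (hm.comp ((measurable_acceptReject am).comp
              (measurable_prodMk_left (x := (x, x'))))) fun u => hC _
          dsimp only
          rw [integral_const_mul, integral_sub (j _ _) (j _ _), integral_acceptReject ha,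
            integral_acceptReject ha]
    _ = _ := by
        rw [integral_candidateLaw_alternative hfst hsnd ha hm hC H.integrable_weight, add_comm,
          alternativeIntegral, flipIntegral, ← mp.map_eq, integral_map mp.measurable.aemeasurable]
        have : Measurable fun p : X × X => da p.1 p.2 * (h p.2 - h p.1) := by fun_prop
        exact this.aestronglyMeasurable

theorem isLoopLaw_nextLaw {π' : Measure X} [IsProbabilityMeasure π'] (H : IsLoopLaw π L)
    (ha : IsAcceptProb a)
    (hda : Measurable fun p : X × X => da p.1 p.2) (hf : Measurable f) (hfC : ∀ x, |f x| ≤ C)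
    (hfst : ∀ x y, (qxy (x, y)).map Prod.fst = κ x)
    (hw : Integrable (fun s => s.2.2.1) (nextLaw a da f qxy L))
    (hπ' : ∀ (h : X → ℝ) (C : ℝ), Measurable h → (∀ x, |h x| ≤ C) →
      ∫ p, (h p.1 + a p.1 p.2 * (h p.2 - h p.1)) ∂(π ⊗ₘ κ) = ∫ x, h x ∂π') :
    IsLoopLaw π' (nextLaw a da f qxy L) ∧
    ∫ s, s.2.2.2 ∂(nextLaw a da f qxy L) =
      ∫ s, s.2.2.2 ∂L + alternativeIntegral (nextLaw a da f qxy L) f := by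
  have := H.isProbabilityMeasure
  obtain rfl := H.map_fst
  have mp := measurePreserving_candidateLaw_primal (L := L) hfst
  have mpL := measurePreserving_candidateLaw_fst (L := L) (qxy := qxy)
  have am := ha.measurable
  have mst : Measurable fun r : ((DState X × (X × X)) × I) × I =>
      dmhStep a da f r.1.1.1 (r.1.1.2, r.1.2, r.2) :=
    (measurable_dmhStep am hda hf).comp
      (f := fun r : ((DState X × (X × X)) × I) × I => (r.1.1.1, (r.1.1.2, r.1.2, r.2)))
      (by fun_prop)
  have hnext := nextLaw_eq_map (qxy := qxy) (L := L) am hda hf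
  have pN : IsProbabilityMeasure (nextLaw a da f qxy L) := by
    rw [hnext]; exact Measure.isProbabilityMeasure_map mst.aemeasurable
  set Q := candidateLaw qxy L with hQ
  have mpR : MeasurePreserving (fun r : ((DState X × (X × X)) × I) × I => r.1.1.1)
      ((Q.prod volume).prod volume) L :=
    (mpL.comp (measurePreserving_fst (μ := Q) (ν := (volume : Measure I)))).comp
      (measurePreserving_fst (μ := Q.prod volume) (ν := (volume : Measure I)))
  have mx : Measurable fun z : (DState X × (X × X)) × I => acceptReject a z.1.1.1 z.1.2.1 z.2 :=
    (measurable_acceptReject am).comp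
      (f := fun z : (DState X × (X × X)) × I => ((z.1.1.1, z.1.2.1), z.2)) (by fun_prop)
  have iΦ : Integrable (fun s : DState X => s.2.2.1 * (f s.2.1 - f s.1))
      (nextLaw a da f qxy L) :=
    hw.mul_bdd (c := C + C) (by fun_prop)
      (ae_of_all _ fun z => (abs_sub _ _).trans (add_le_add (hfC _) (hfC _)))
  -- Composed with the step, this function is exactly the increment of the running estimate, since
  -- the step evaluates f at the updated states.
  have iΦ' : Integrable ((fun s : DState X => s.2.2.1 * (f s.2.1 - f s.1)) ∘
      fun r : ((DState X × (X × X)) × I) × I => dmhStep a da f r.1.1.1 (r.1.1.2, r.1.2, r.2))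
      ((Q.prod volume).prod volume) := by
    rw [← integrable_map_measure (by fun_prop) mst.aemeasurable, ← hnext]
    exact iΦ
  have iS : Integrable (fun r : ((DState X × (X × X)) × I) × I => r.1.1.1.2.2.2)
      ((Q.prod volume).prod volume) :=
    mpR.integrable_comp_of_integrable H.integrable_sum
  refine ⟨⟨pN, ?_, ?_, hw, ?_⟩, ?_⟩
  · have : IsProbabilityMeasure ((nextLaw a da f qxy L).map Prod.fst) :=
      Measure.isProbabilityMeasure_map measurable_fst.aemeasurable
    -- The law is identified through indicators, treated as bounded test functions for `hπ'`.
    refine Measure.ext fun E hE => ?_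
    rw [← measureReal_eq_measureReal_iff, ← integral_indicator_one hE, ← integral_indicator_one hE]
    have hm : Measurable (E.indicator (1 : X → ℝ)) := measurable_one.indicator hE
    have hC1 : ∀ x, |E.indicator (1 : X → ℝ) x| ≤ 1 := fun x => by
      by_cases hx : x ∈ E <;> simp [hx]
    generalize E.indicator (1 : X → ℝ) = h at hm hC1
    rw [integral_map measurable_fst.aemeasurable hm.aestronglyMeasurable, hnext,
      integral_map mst.aemeasurable (by exact (hm.comp measurable_fst).aestronglyMeasurable),
      ← hπ' h 1 hm hC1]
    have i1 : Integrable (fun z : (DState X × (X × X)) × I =>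
        h (acceptReject a z.1.1.1 z.1.2.1 z.2)) (Q.prod volume) :=
      integrable_of_abs_le (hm.comp mx) fun z => hC1 _
    calc _ = ∫ r : ((DState X × (X × X)) × I) × I,
            h (acceptReject a r.1.1.1.1 r.1.1.2.1 r.1.2) ∂((Q.prod volume).prod volume) := rfl
      _ = ∫ z : (DState X × (X × X)) × I,
            h (acceptReject a z.1.1.1 z.1.2.1 z.2) ∂(Q.prod volume) := by
          rw [integral_fun_fst (fun z : (DState X × (X × X)) × I =>
            h (acceptReject a z.1.1.1 z.1.2.1 z.2))]
          simp
      _ = ∫ r, (h r.1.1 + a r.1.1 r.2.1 * (h r.2.1 - h r.1.1)) ∂Q := by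
          rw [integral_prod _ i1]
          simp only [integral_acceptReject ha]
      _ = _ := by
          rw [← mp.map_eq, integral_map mp.measurable.aemeasurable
            (ha.measurable_mix hm).aestronglyMeasurable]
  · rw [hnext, ae_map_iff mst.aemeasurable (measurableSet_le measurable_const (by fun_prop))]
    filter_upwards [mpR.quasiMeasurePreserving.ae H.weight_nonneg] with r hr
    exact add_nonneg (flipWeight_nonneg ha da _ _ _) (keptWeight_nonneg a hr _ _)
  · rw [hnext, integrable_map_measure measurable_sum.aestronglyMeasurable mst.aemeasurable]
    exact iS.add iΦ'
  · rw [alternativeIntegral, hnext, 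
      integral_map mst.aemeasurable measurable_sum.aestronglyMeasurable,
      integral_map mst.aemeasurable (by
        exact (measurable_weight.mul (by fun_prop)).aestronglyMeasurable), ← mpR.map_eq,
      integral_map mpR.measurable.aemeasurable measurable_sum.aestronglyMeasurable]
    exact integral_add iS iΦ'

end NextLaw

end DiffMH

/-! ### Unrolling the loop -/

namespace DiffMH

variable {X : Type*} [MeasurableSpace X]

section Loop

variable [MeasurableEq X] {κ : Kernel X X} [IsMarkovKernel κ] {qxy : Kernel (X × X) (X × X)}
  [IsMarkovKernel qxy] {a : ℝ → X → X → ℝ} {θ : ℝ} {π : ℕ → Measure X} {D K : X × X → ℝ} {N : ℕ}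
  {f h : X → ℝ} {C : ℝ} {x₁ : X}

omit [MeasurableEq X] [IsMarkovKernel qxy] in
theorem dmhLaw_succ (a da : X → X → ℝ) (f : X → ℝ) (qxy : Kernel (X × X) (X × X)) (x₁ : X)
    (n : ℕ) : dmhLaw a da f qxy x₁ (n + 1) = nextLaw a da f qxy (dmhLaw a da f qxy x₁ n) :=
  rfl

/-- The induction has to carry the formula for all bounded h, since one iteration replaces h by its
image under the transition operator. The running estimate collects the case h = f once per
iteration, hence the outer sum over m; its term m = 0 is empty. -/
theorem IsRegularChain.isLoopLaw_dmhLaw (R : IsRegularChain κ a θ π D K N)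
    (hfst : ∀ x y, (qxy (x, y)).map Prod.fst = κ x)
    (hsnd : ∀ x y, (qxy (x, y)).map Prod.snd = κ y)
    (hπ0 : π 0 = Measure.dirac x₁) (hf : Measurable f) (hfC : ∀ x, |f x| ≤ C) (n : ℕ)
    (hn : n ≤ N) :
    IsLoopLaw (π n) (dmhLaw (a θ) (fun x x' => D (x, x')) f qxy x₁ n) ∧
    (∀ (h : X → ℝ) (C : ℝ), Measurable h → (∀ x, |h x| ≤ C) →
      alternativeIntegral (dmhLaw (a θ) (fun x x' => D (x, x')) f qxy x₁ n) h =
        ∑ i ∈ Finset.range n, flipIntegral κ D (π i) ((acceptOp κ (a θ))^[n - 1 - i] h)) ∧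
    ∫ s, s.2.2.2 ∂(dmhLaw (a θ) (fun x x' => D (x, x')) f qxy x₁ n) =
      ∑ m ∈ Finset.range (n + 1), ∑ i ∈ Finset.range m,
        flipIntegral κ D (π i) ((acceptOp κ (a θ))^[m - 1 - i] f) := by
  induction n with
  | zero =>
    simp only [dmhLaw, alternativeIntegral]
    refine ⟨⟨inferInstance, ?_, ?_, ?_, ?_⟩, fun h C hm _ => ?_, ?_⟩
    · rw [hπ0, Measure.map_dirac' measurable_fst]
    · rw [ae_dirac_iff (measurableSet_le measurable_const measurable_weight)]
    · exact integrable_dirac' measurable_weight.stronglyMeasurable (by simp)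
    · exact integrable_dirac' measurable_sum.stronglyMeasurable (by simp)
    · rw [integral_dirac' _ _ (by
        exact (measurable_weight.mul (by fun_prop)).stronglyMeasurable)]
      simp
    · rw [integral_dirac' _ _ measurable_sum.stronglyMeasurable]
      simp
  | succ n ih =>
    obtain ⟨H, hA, hS⟩ := ih (by omega)
    have := R.isProbabilityMeasure
    rw [dmhLaw_succ]
    set L := dmhLaw (a θ) (fun x x' => D (x, x')) f qxy x₁ n with hL
    have next := fun (h : X → ℝ) (C : ℝ) (hm : Measurable h) (hC : ∀ x, |h x| ≤ C) =>
      alternativeIntegral_nextLaw (qxy := qxy) H (R.isAcceptProb θ) (da := fun x x' => D (x, x'))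
        R.measurable_deriv hf hfst hsnd (R.integrable_deriv (by omega))
        (R.deriv_eq_zero_of_eq_zero (by omega)) (R.deriv_eq_zero_of_eq_one (by omega)) hm hC
    have hA' : ∀ (h : X → ℝ) (C : ℝ), Measurable h → (∀ x, |h x| ≤ C) →
        alternativeIntegral (nextLaw (a θ) (fun x x' => D (x, x')) f qxy L) h =
          ∑ i ∈ Finset.range (n + 1),
            flipIntegral κ D (π i) ((acceptOp κ (a θ))^[n + 1 - 1 - i] h) := by
      intro h C hm hC
      rw [(next h C hm hC).2, hA _ C (measurable_acceptOp (R.isAcceptProb θ) hm)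
        (abs_acceptOp_le (R.isAcceptProb θ) hC), Finset.sum_range_succ]
      congr 1
      · refine Finset.sum_congr rfl fun i hi => ?_
        rw [← Function.iterate_succ_apply,
          show (n - 1 - i).succ = n + 1 - 1 - i by have := Finset.mem_range.1 hi; omega]
      · simp
    have step := isLoopLaw_nextLaw (qxy := qxy) (π' := π (n + 1)) H (R.isAcceptProb θ)
      (da := fun x x' => D (x, x')) R.measurable_deriv hf hfC hfst (next f C hf hfC).1
      (fun h C hm hC => R.integral_mix hm hC)
    refine ⟨step.1, hA', ?_⟩
    rw [step.2, hS, hA' f C hf hfC, ← Finset.sum_range_succ]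

omit [MeasurableEq X] in
/-- The iterations only see the derivative of the acceptance probability up to null sets. -/
theorem dmhLaw_congr {a da D : X → X → ℝ} {N : ℕ}
    (hfst : ∀ x y, (qxy (x, y)).map Prod.fst = κ x)
    (hL : ∀ n ≤ N, IsLoopLaw (π n) (dmhLaw a D f qxy x₁ n))
    (hda : ∀ n < N, ∀ᵐ p ∂(π n ⊗ₘ κ), da p.1 p.2 = D p.1 p.2) (n : ℕ) (hn : n ≤ N) :
    dmhLaw a da f qxy x₁ n = dmhLaw a D f qxy x₁ n := by
  induction n with
  | zero => rfl
  | succ n ih =>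
    have H := hL n (by omega)
    have := H.isProbabilityMeasure
    simp only [dmhLaw]
    rw [ih (by omega)]
    refine Measure.map_congr ?_
    have mp := measurePreserving_candidateLaw_primal (L := dmhLaw a D f qxy x₁ n) hfst
    rw [H.map_fst] at mp
    have mp' := (mp.comp (measurePreserving_fst (ν := (volume : Measure I)))).comp
      (measurePreserving_fst (ν := (volume : Measure I)))
    rw [compProd_noiseKernel]
    -- The step with the raw derivative `da` need not be measurable, so the null set is pulled back
    -- along a rearrangement of coordinates that is a measurable equivalence.
    have e : MeasurableEmbedding fun r : ((DState X × (X × X)) × I) × I =>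
        (r.1.1.1, (r.1.1.2, r.1.2, r.2)) :=
      ((MeasurableEquiv.prodAssoc (α := DState X × (X × X)) (β := I) (γ := I)).trans
        MeasurableEquiv.prodAssoc).measurableEmbedding
    rw [EventuallyEq, e.ae_map_iff]
    filter_upwards [mp'.quasiMeasurePreserving.ae (hda n (by omega))] with r hr
    have hr' : da r.1.1.1.1 r.1.1.2.1 = D r.1.1.1.1 r.1.1.2.1 := hr
    have hw : flipWeight a da r.1.1.1.1 r.1.1.2.1 r.1.2 =
        flipWeight a D r.1.1.1.1 r.1.1.2.1 r.1.2 := by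
      simp only [flipWeight, hr']
    rw [dmhStep_eq, dmhStep_eq, hw]

end Loop

/-! ### The sampler as iterates of the transition operator -/

section Sampler

theorem measurable_acceptProb {g : X → ℝ≥0} {q : X → X → ℝ≥0} (hg : Measurable g)
    (hq : Measurable (Function.uncurry q)) :
    Measurable fun p : X × X => acceptProb g q p.1 p.2 := by
  have hq' : Measurable fun p : X × X => q p.1 p.2 := hq
  have hq'' : Measurable fun p : X × X => q p.2 p.1 := hq.comp measurable_swap
  exact Measurable.ite (((hg.comp measurable_fst).mul hq') (measurableSet_singleton 0))
    measurable_const (by fun_prop)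

theorem isAcceptProb_acceptProb {g : X → ℝ≥0} {q : X → X → ℝ≥0} (hg : Measurable g)
    (hq : Measurable (Function.uncurry q)) : IsAcceptProb (acceptProb g q) where
  measurable := measurable_acceptProb hg hq
  nonneg x x' := by
    unfold acceptProb
    split_ifs
    · exact zero_le_one
    · exact le_min zero_le_one (by positivity)
  le_one x x' := by
    unfold acceptProb
    split_ifs
    · exact le_rfl
    · exact min_le_left _ _

theorem isMarkovKernel_proposalKernel (lam : Measure X) [SigmaFinite lam] {q : X → X → ℝ≥0}
    (hq : Measurable (Function.uncurry q)) (hq1 : ∀ x, ∫⁻ x', (q x x' : ℝ≥0∞) ∂lam = 1) :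
    IsMarkovKernel (proposalKernel lam q) := by
  refine ⟨fun x => ⟨?_⟩⟩
  rw [proposalKernel, Kernel.withDensity_apply _ (by exact hq.coe_nnreal_ennreal),
    withDensity_apply _ MeasurableSet.univ, Measure.restrict_univ, Kernel.const_apply, hq1]

variable {lam : Measure X} [SigmaFinite lam] {g : X → ℝ≥0} {q : X → X → ℝ≥0}

theorem isMarkovKernel_mhKernel [IsMarkovKernel (proposalKernel lam q)] (hg : Measurable g)
    (hq : Measurable (Function.uncurry q)) : IsMarkovKernel (mhKernel lam g q) :=
  Kernel.IsMarkovKernel.map _ ((measurable_acceptReject (measurable_acceptProb hg hq)).comp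
    (f := fun p : X × X × I => ((p.1, p.2.1), p.2.2)) (by fun_prop))

theorem integral_mhKernel [IsMarkovKernel (proposalKernel lam q)] (hg : Measurable g)
    (hq : Measurable (Function.uncurry q)) {h : X → ℝ} {C : ℝ} (hm : Measurable h)
    (hC : ∀ x, |h x| ≤ C) (x : X) :
    ∫ y, h y ∂(mhKernel lam g q x) = acceptOp (proposalKernel lam q) (acceptProb g q) h x := by
  have ma : Measurable fun p : X × X × I => acceptReject (acceptProb g q) p.1 p.2.1 p.2.2 :=
    (measurable_acceptReject (measurable_acceptProb hg hq)).comp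
      (f := fun p : X × X × I => ((p.1, p.2.1), p.2.2)) (by fun_prop)
  rw [mhKernel, Kernel.map_apply _ ma, integral_map ma.aemeasurable hm.aestronglyMeasurable,
    Kernel.prod_apply, Kernel.prod_apply, Kernel.id_apply, Kernel.const_apply,
    integral_prod (fun p : X × X × I => h (acceptReject (acceptProb g q) p.1 p.2.1 p.2.2))
      (integrable_of_abs_le (hm.comp ma) fun p => hC _),
    integral_dirac' _ _ (by
      exact (hm.comp ma).stronglyMeasurable.integral_prod_right')]
  have mx : Measurable fun p : X × I => acceptReject (acceptProb g q) x p.1 p.2 :=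
    ma.comp measurable_prodMk_left
  rw [integral_prod (fun p : X × I => h (acceptReject (acceptProb g q) x p.1 p.2))
    (integrable_of_abs_le (hm.comp mx) fun p => hC _)]
  simp only [integral_acceptReject (isAcceptProb_acceptProb hg hq)]
  rfl

variable {Ω : Type*} [MeasurableSpace Ω] {P : Measure Ω} [IsProbabilityMeasure P] {x₁ : X}
  {Z : ℕ → Ω → X}

theorem IsMHSampler.map_one (hZ : IsMHSampler lam g q x₁ P Z) :
    P.map (Z 1) = Measure.dirac x₁ := by
  rw [Measure.map_congr (show Z 1 =ᵐ[P] fun _ => x₁ from hZ.init), Measure.map_const]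
  simp

/-- The step law given the whole history reads off only the latest state, so integrating out the
past leaves a recursion for the one-time marginals. -/
theorem IsMHSampler.integral_succ [IsMarkovKernel (proposalKernel lam q)]
    (hZ : IsMHSampler lam g q x₁ P Z) (hg : Measurable g)
    (hq : Measurable (Function.uncurry q)) {h : X → ℝ} {C : ℝ} (hm : Measurable h)
    (hC : ∀ x, |h x| ≤ C) {t : ℕ} (ht : 1 ≤ t) :
    ∫ x, h x ∂(P.map (Z (t + 1))) =
      ∫ x, acceptOp (proposalKernel lam q) (acceptProb g q) h x ∂(P.map (Z t)) := by
  have := isMarkovKernel_mhKernel (lam := lam) hg hq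
  have mH : Measurable fun ω => (fun i : Finset.Icc 1 t => Z i ω) :=
    measurable_pi_lambda _ fun i => hZ.measurable i (Finset.mem_Icc.1 i.2).1
  have := Measure.isProbabilityMeasure_map (μ := P) mH.aemeasurable
  have m1 := hZ.measurable (t + 1) (by omega)
  have mA := measurable_acceptOp (κ := proposalKernel lam q) (isAcceptProb_acceptProb hg hq) hm
  have e := congrArg (fun m => ∫ p, h p.2 ∂m) (hZ.step t ht)
  beta_reduce at e
  rw [integral_map (mH.prodMk m1).aemeasurable (by
      exact (hm.comp measurable_snd).aestronglyMeasurable),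
    Measure.integral_compProd (by
      exact integrable_of_abs_le (hm.comp measurable_snd) fun p => hC _)] at e
  simp only [Kernel.comap_apply, integral_mhKernel hg hq hm hC] at e
  rw [integral_map m1.aemeasurable hm.aestronglyMeasurable, e,
    integral_map mH.aemeasurable (by
      exact (mA.comp (measurable_pi_apply _)).aestronglyMeasurable),
    integral_map (hZ.measurable t ht).aemeasurable mA.aestronglyMeasurable]

/-- The last transition is absorbed into the test function, so the induction runs over all bounded
h. -/
theorem IsMHSampler.integral_eq_iterate [IsMarkovKernel (proposalKernel lam q)]
    (hZ : IsMHSampler lam g q x₁ P Z) (hg : Measurable g)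
    (hq : Measurable (Function.uncurry q)) {h : X → ℝ} {C : ℝ} (hm : Measurable h)
    (hC : ∀ x, |h x| ≤ C) (n : ℕ) :
    ∫ ω, h (Z (n + 1) ω) ∂P =
      ∫ x, (acceptOp (proposalKernel lam q) (acceptProb g q))^[n] h x ∂(Measure.dirac x₁) := by
  rw [← integral_map (hZ.measurable (n + 1) (by omega)).aemeasurable hm.aestronglyMeasurable]
  induction n generalizing h with
  | zero => simp [hZ.map_one]
  | succ n ih =>
    have ha := isAcceptProb_acceptProb hg hq
    rw [hZ.integral_succ hg hq hm hC (by omega), ih (measurable_acceptOp ha hm)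
      (abs_acceptOp_le ha hC)]
    rfl

end Sampler

/-- The derivative in a parameter of a family of measurable functions is almost everywhere
measurable if the family is almost everywhere differentiable. -/
theorem aemeasurable_deriv_param {α : Type*} [MeasurableSpace α] {μ : Measure α}
    {F : ℝ → α → ℝ} {θ : ℝ} (hF : ∀ η, Measurable (F η))
    (hd : ∀ᵐ p ∂μ, DifferentiableAt ℝ (fun η => F η p) θ) :
    AEMeasurable (fun p => deriv (fun η => F η p) θ) μ := by
  refine aemeasurable_of_tendsto_metrizable_ae (𝓝[≠] θ)
    (f := fun η p => slope (fun η => F η p) θ η) (fun η => ?_) ?_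
  · simp only [slope_def_field]
    exact (((hF η).sub (hF θ)).div_const _).aemeasurable
  · filter_upwards [hd] with p hp
    exact hasDerivAt_iff_tendsto_slope.1 hp.hasDerivAt

end DiffMH

/-! ### Matching the two sums -/

theorem theorem1 {X : Type*} [MeasurableSpace X] [MeasurableEq X]
    -- reference measure, targets with unnormalized densities, proposal density
    (lam : Measure X) [SigmaFinite lam]
    (μ : ℝ → Measure X) [∀ θ, IsProbabilityMeasure (μ θ)]
    (g : ℝ → X → ℝ≥0) (hg : ∀ θ, Measurable (g θ))
    (hμ : ∀ θ, ∃ c : ℝ≥0, c ≠ 0 ∧ lam.withDensity (fun x => (g θ x : ℝ≥0∞)) = c • μ θ)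
    (q : X → X → ℝ≥0) (hq : Measurable (Function.uncurry q))
    (hq1 : ∀ x, ∫⁻ x', (q x x' : ℝ≥0∞) ∂lam = 1)
    -- proposal coupling
    (qxy : Kernel (X × X) (X × X)) [IsMarkovKernel qxy]
    (hqxy : DiffMH.IsProposalCoupling lam q qxy)
    -- test function, start state, number of samples
    (f : X → ℝ) (hf : Measurable f) (hfb : ∃ C : ℝ, ∀ x, |f x| ≤ C)
    (x₁ : X) (T : ℕ) (hT : 1 ≤ T)
    -- Metropolis-Hastings samplers of the targets
    {Ω : Type*} [MeasurableSpace Ω] (P : ℝ → Measure Ω) [∀ θ, IsProbabilityMeasure (P θ)]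
    (Z : ℝ → ℕ → Ω → X)
    (hZ : ∀ θ, DiffMH.IsMHSampler lam (g θ) q x₁ (P θ) (Z θ))
    -- regularity at `θ` of the acceptance probability along the chain
    (θ : ℝ)
    (hdiff : ∀ t, 1 ≤ t → t < T →
      ∀ᵐ p ∂(((P θ).map (Z θ t)) ⊗ₘ DiffMH.proposalKernel lam q),
        DifferentiableAt ℝ (fun η : ℝ => DiffMH.acceptProb (g η) q p.1 p.2) θ)
    (K : X × X → ℝ)
    (hK : ∀ t, 1 ≤ t → t < T →
      Integrable K (((P θ).map (Z θ t)) ⊗ₘ DiffMH.proposalKernel lam q))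
    (hdom : ∀ t, 1 ≤ t → t < T →
      ∀ᶠ η in 𝓝 θ, ∀ᵐ p ∂(((P θ).map (Z θ t)) ⊗ₘ DiffMH.proposalKernel lam q),
        |DiffMH.acceptProb (g η) q p.1 p.2 - DiffMH.acceptProb (g θ) q p.1 p.2|
          ≤ K p * |η - θ|) :
    IsProbabilityMeasure (DiffMH.dmhOutputLaw g q f qxy x₁ T θ) ∧
    Integrable (fun s : ℝ => s) (DiffMH.dmhOutputLaw g q f qxy x₁ T θ) ∧
    HasDerivAt
      (fun η : ℝ => ∫ ω, (1 / (T : ℝ)) * ∑ t ∈ Finset.Icc 1 T, f (Z η t ω) ∂(P η))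
      (∫ s, s ∂(DiffMH.dmhOutputLaw g q f qxy x₁ T θ)) θ := by
  obtain ⟨C, hC⟩ := hfb
  obtain ⟨N, rfl⟩ : ∃ N, T = N + 1 := ⟨T - 1, by omega⟩
  have := DiffMH.isMarkovKernel_proposalKernel lam hq hq1
  have ha := fun η => DiffMH.isAcceptProb_acceptProb (hg η) hq
  set κ := DiffMH.proposalKernel lam q with hκ
  set a : ℝ → X → X → ℝ := fun η => DiffMH.acceptProb (g η) q with hadef
  set da : X → X → ℝ := fun x x' => deriv (fun η : ℝ => a η x x') θ with hda
  -- Times are shifted by one: π t is the law after t transitions, and T = N + 1 samples use N of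
  -- them.
  set π : ℕ → Measure X := fun t => (P θ).map (Z θ (t + 1)) with hπ
  have hπ0 : π 0 = Measure.dirac x₁ := (hZ θ).map_one
  -- Summing the laws of state and candidate over all times allows a single measurable version D of
  -- the derivative that is valid at every time.
  set ν : Measure (X × X) := Measure.sum fun t : Fin N => π t ⊗ₘ κ with hν
  have hdν : ∀ᵐ p ∂ν, DifferentiableAt ℝ (fun η => a η p.1 p.2) θ :=
    Measure.ae_sum_iff.2 fun t => hdiff (t + 1) (by omega) (by omega)
  have hmeas : AEMeasurable (fun p : X × X => da p.1 p.2) ν :=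
    DiffMH.aemeasurable_deriv_param (F := fun η (p : X × X) => a η p.1 p.2)
      (fun η => (ha η).measurable) hdν
  set D := hmeas.mk with hD
  have hDν : ∀ t < N, ∀ᵐ p ∂(π t ⊗ₘ κ), da p.1 p.2 = D p := fun t ht =>
    Measure.ae_sum_iff.1 hmeas.ae_eq_mk ⟨t, ht⟩
  have R : DiffMH.IsRegularChain κ a θ π D K N :=
    { isProbabilityMeasure := fun t =>
        Measure.isProbabilityMeasure_map ((hZ θ).measurable _ (by omega)).aemeasurable
      isAcceptProb := ha
      integral_succ := fun t h C hm hC => (hZ θ).integral_succ (hg θ) hq hm hC (by omega)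
      measurable_deriv := hmeas.measurable_mk
      hasDerivAt := fun t ht => by
        filter_upwards [hDν t ht, hdiff (t + 1) (by omega) (by omega)] with p h1 h2
        rw [← h1]
        exact h2.hasDerivAt
      integrable_bound := fun t ht => hK (t + 1) (by omega) (by omega)
      lipschitz := fun t ht => hdom (t + 1) (by omega) (by omega) }
  have hloop := fun n hn =>
    R.isLoopLaw_dmhLaw (qxy := qxy) hqxy.fst_eq hqxy.snd_eq hπ0 hf hC n hn
  have hlaw := DiffMH.dmhLaw_congr (κ := κ) (f := f) (da := da) (D := fun x x' => D (x, x'))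
    hqxy.fst_eq (fun n hn => (hloop n hn).1) hDν N le_rfl
  obtain ⟨H, -, hS⟩ := hloop N le_rfl
  have hprob := H.isProbabilityMeasure
  have hout : DiffMH.dmhOutputLaw g q f qxy x₁ (N + 1) θ =
      (DiffMH.dmhLaw (a θ) (fun x x' => D (x, x')) f qxy x₁ N).map
        (fun s => s.2.2.2 / ((N + 1 : ℕ) : ℝ)) := by
    rw [← hlaw]
    rfl
  have mo : Measurable fun s : DiffMH.DState X => s.2.2.2 / ((N + 1 : ℕ) : ℝ) := by fun_prop
  rw [hout]
  refine ⟨Measure.isProbabilityMeasure_map mo.aemeasurable, ?_, ?_⟩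
  · rw [integrable_map_measure (by fun_prop) mo.aemeasurable]
    exact H.integrable_sum.div_const _
  · rw [integral_map mo.aemeasurable (by fun_prop), integral_div, hS]
    -- Only one-time marginals enter, so the samplers at different η need no joint construction.
    -- Sample t corresponds to m = t - 1 transitions from the common start law π 0.
    have e : (fun η : ℝ => ∫ ω, (1 / ((N + 1 : ℕ) : ℝ)) *
          ∑ t ∈ Finset.Icc 1 (N + 1), f (Z η t ω) ∂(P η)) =
        fun η => (1 / ((N + 1 : ℕ) : ℝ)) * ∑ m ∈ Finset.range (N + 1),
          ∫ x, (DiffMH.acceptOp κ (a η))^[m] f x ∂(π 0) := by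
      funext η
      rw [integral_const_mul, integral_finsetSum _ (by
        exact fun t ht => DiffMH.integrable_of_abs_le
          (hf.comp ((hZ η).measurable t (Finset.mem_Icc.1 ht).1)) fun ω => hC _),
        ← Finset.Ico_add_one_right_eq_Icc, Finset.sum_Ico_eq_sum_range]
      congr 1
      refine Finset.sum_congr (by simp) fun m _ => ?_
      rw [hπ0, add_comm]
      exact (hZ η).integral_eq_iterate (hg η) hq hf hC m
    rw [e]
    have key : HasDerivAt (fun η => ∑ m ∈ Finset.range (N + 1),
        ∫ x, (DiffMH.acceptOp κ (a η))^[m] f x ∂(π 0))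
        (∑ m ∈ Finset.range (N + 1), ∑ i ∈ Finset.range m,
          DiffMH.flipIntegral κ D (π i) ((DiffMH.acceptOp κ (a θ))^[m - 1 - i] f)) θ := by
      refine HasDerivAt.fun_sum fun m hm => ?_
      have := R.hasDerivAt_integral_iterate hf hC m 0 (by have := Finset.mem_range.1 hm; omega)
      simpa only [zero_add] using this
    have := key.const_mul (1 / ((N + 1 : ℕ) : ℝ))
    rwa [one_div_mul_eq_div] at this
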